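/- Let $\alpha>0$ and $p>5$ be real numbers. Write points of $\mathbb{R}^3$ as $(x_1,x_2,y)$, put $x=(x_1,x_2)$ and $|x|=\sqrt{x_1^2+x_2^2}$. Let $\Omega\subset\mathbb{R}^3$ be a bounded domain with $C^\infty$ boundary and outward unit normal $\nu=(\nu_1,\nu_2,\nu_3)$. Assume that $\Omega$ is $G_\alpha$-star-shaped with respect to the origin, that is, $(0,0,0)\in\Omega$ and $$x_1\nu_1+x_2\nu_2+(1+\alpha)\,y\,\nu_3\ \ge\ 0\qquad\text{at every point of }\partial\Omega .$$ Let $\mathcal{S}_2(\overline\Omega)$ be the space of real functions $u\in C^1(\overline\Omega)$ with $u=0$ on $\partial\Omega$ such that the distributions $\frac{\partial^2u}{\partial x_1^2}$, $\frac{\partial^2u}{\partial x_2^2}$ and $|x|^{2\alpha}\frac{\partial^2u}{\partial y^2}$ on $\Omega$ are continuous functions in $\Omega$ that extend continuously to $\overline\Omega$. Here $C^1(\overline\Omega)$ means continuous on $\overline\Omega$ and $C^1$ in $\Omega$ with first partial derivatives extending continuously to $\overline\Omega$, and $|x|^{2\alpha}\frac{\partial^2u}{\partial y^2}$ denotes the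 distribution $\frac{\partial^2}{\partial y^2}\big(|x|^{2\alpha}u\big)$. Then the problem $$-\frac{\partial^2u}{\partial x_1^2}-\frac{\partial^2u}{\partial x_2^2}-|x|^{2\alpha}\frac{\partial^2u}{\partial y^2}=|x|^{2\alpha}|u|^{p-1}u\ \text{ in }\Omega,\qquad u=0\ \text{ on }\partial\Omega,$$ has no nontrivial solution $u\in\mathcal{S}_2(\overline\Omega)$; that is, the only solution in $\mathcal{S}_2(\overline\Omega)$ is $u\equiv 0$ on $\overline\Omega$. -/

import Mathlib

open MeasureTheory Set TopologicalSpace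
open scoped ContDiff Distributions

noncomputable section

namespace Grushin

/-- Points `(x₁, x₂, y)` of `ℝ³`: the coordinates `0`, `1` are `x₁`, `x₂`, the coordinate `2` is `y`. -/
abbrev Space3 : Type := EuclideanSpace ℝ (Fin 3)

/-- `|x| = √(x₁² + x₂²)` at the point `(x₁, x₂, y)`. -/
def horizontalNorm (z : Space3) : ℝ := Real.sqrt (z 0 ^ 2 + z 1 ^ 2)

/-- The weight `|x|^{2α}`. -/
def weight (α : ℝ) (z : Space3) : ℝ := horizontalNorm z ^ (2 * α)

/-- `ρ` is a smooth defining function of `Ω` in the open neighbourhood `U` of the point `z`: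
inside `U` the set `Ω` is `{ρ < 0}`, and `∇ρ(z) ≠ 0`. -/
structure IsLocalDefiningFunction (Ω : Set Space3) (z : Space3) (U : Set Space3)
    (ρ : Space3 → ℝ) : Prop where
  isOpen : IsOpen U
  mem : z ∈ U
  smooth : ContDiffOn ℝ ∞ ρ U
  inter_eq : Ω ∩ U = {w | ρ w < 0} ∩ U
  gradient_ne_zero : gradient ρ z ≠ 0

/-- A bounded smooth domain of `ℝ³`: the open set `Ω` is connected (so nonempty) and bounded, with
`C^∞` boundary, and lies locally on one side of the boundary. -/
structure IsBoundedSmoothDomain (Ω : Opens Space3) : Prop where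
  isConnected : IsConnected (Ω : Set Space3)
  isBounded : Bornology.IsBounded (Ω : Set Space3)
  smooth_boundary : ∀ z ∈ frontier (Ω : Set Space3), ∃ U ρ, IsLocalDefiningFunction Ω z U ρ

/-- `ν` is the outward unit normal to `∂Ω` at the boundary point `z`, that is,
`ν = ∇ρ(z) / ‖∇ρ(z)‖` for a local defining function `ρ`. -/
def IsOutwardUnitNormal (Ω : Set Space3) (z ν : Space3) : Prop :=
  ∃ U ρ, IsLocalDefiningFunction Ω z U ρ ∧ ν = ‖gradient ρ z‖⁻¹ • gradient ρ z

/-- `G_α`-star-shapedness with respect to the origin. -/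
def IsStarShaped (α : ℝ) (Ω : Opens Space3) : Prop :=
  (0 : Space3) ∈ Ω ∧ ∀ z ∈ frontier (Ω : Set Space3), ∀ ν, IsOutwardUnitNormal Ω z ν →
    0 ≤ z 0 * ν 0 + z 1 * ν 1 + (1 + α) * z 2 * ν 2

/-- The classical partial derivative in the `i`-th coordinate. -/
def partialDeriv (i : Fin 3) (u : Space3 → ℝ) (z : Space3) : ℝ :=
  fderiv ℝ u z (EuclideanSpace.single i 1)

/-- The second derivative `∂ᵢ²v` in the sense of distributions on `Ω` is the function `g`. -/
def IsDistribSecondDeriv (Ω : Opens Space3) (i : Fin 3) (v g : Space3 → ℝ) : Prop :=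
  ∀ φ : 𝓓(Ω, ℝ),
    ∫ z in Ω, v z * partialDeriv i (partialDeriv i φ) z = ∫ z in Ω, g z * φ z

/-- Membership in `C¹₀(Ω̄)`: `u` is continuous on `Ω̄`, of class `C¹` in `Ω`, its first partial
derivatives extend continuously to `Ω̄`, and `u = 0` on `∂Ω`. -/
structure MemC10 (Ω : Opens Space3) (u : Space3 → ℝ) : Prop where
  continuousOn : ContinuousOn u (closure (Ω : Set Space3))
  contDiffOn : ContDiffOn ℝ 1 u Ω
  partialDeriv_extends : ∀ i, ∃ G : Space3 → ℝ,
    ContinuousOn G (closure (Ω : Set Space3)) ∧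
    EqOn G (partialDeriv i u) Ω
  eq_zero_of_mem_frontier : ∀ z ∈ frontier (Ω : Set Space3), u z = 0

/-- `g₁, g₂, g₃` are the continuous extensions to `Ω̄` of the distributions `∂²u/∂x₁²`, `∂²u/∂x₂²`
and `|x|^{2α} ∂²u/∂y²` on `Ω`. Since `|x|^{2α}` does not depend on `y`, the last distribution
is `∂²(|x|^{2α} u)/∂y²`; in this form no smoothness of the weight is needed. -/
structure AreSecondDerivs (α : ℝ) (Ω : Opens Space3) (u g₁ g₂ g₃ : Space3 → ℝ) : Prop where
  continuousOn₁ : ContinuousOn g₁ (closure (Ω : Set Space3))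
  continuousOn₂ : ContinuousOn g₂ (closure (Ω : Set Space3))
  continuousOn₃ : ContinuousOn g₃ (closure (Ω : Set Space3))
  deriv₁ : IsDistribSecondDeriv Ω 0 u g₁
  deriv₂ : IsDistribSecondDeriv Ω 1 u g₂
  deriv₃ : IsDistribSecondDeriv Ω 2 (fun z => weight α z * u z) g₃

/-- Membership in `S₂(Ω̄)`. -/
def MemS2 (α : ℝ) (Ω : Opens Space3) (u : Space3 → ℝ) : Prop :=
  MemC10 Ω u ∧ ∃ g₁ g₂ g₃, AreSecondDerivs α Ω u g₁ g₂ g₃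

/-- `u` solves `-Δₓu - |x|^{2α} ∂²u/∂y² = f(·, u)` in `Ω`, `u = 0` on `∂Ω`, where the second
derivatives are the continuous functions that represent the distributional ones. -/
def IsSolution (α : ℝ) (Ω : Opens Space3) (f : Space3 → ℝ → ℝ) (u : Space3 → ℝ) : Prop :=
  (∃ g₁ g₂ g₃, AreSecondDerivs α Ω u g₁ g₂ g₃ ∧
    ∀ z ∈ Ω, -(g₁ z + g₂ z) - g₃ z = f z (u z)) ∧
  ∀ z ∈ frontier (Ω : Set Space3), u z = 0

end Grushin

end

/-!
Put `v = u` on `Ω`, `v = 0` elsewhere, let `v_t = v ∘ δ_t` for the dilations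
`δ_t (x, y) = (eᵗ x, e^{(1+α)t} y)`, and let `F = |x|^{2α} |v|^{p-1} v`. Pohozaev's identity is
the first variation of the energy along `v_t`, and only an inequality between difference quotients
at `t = 0⁺` is needed. Star-shapedness makes `δ_{-t}` map `Ω` into itself, so for `t ≥ 0` the
function `v_t` vanishes off `Ω` and is an admissible test function. Write `E = ∫ F v`, which is
also the energy `∫ |∇_x v|² + |x|^{2α} (∂_y v)²` of `v`.

* Testing the equation with `v_t` and using Young's inequality, `∫ F v_t` is at most half the sum
  of the energies of `v` and `v_t`, that is `(1 + e^{-(1+α)t}) E / 2`.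
* The first-order Taylor expansion of the potential `|v|^{p+1} / (p+1)` gives
  `∫ F (v - v_t) ≤ (1 - e^{-3(1+α)t}) E / (p+1) + O(t²)`.

Comparing the terms of order `t` gives `E / 2 ≤ 3 E / (p+1)`, hence `E ≤ 0` as `p > 5`.

No regularity of `u` at the boundary beyond a bounded gradient is used: `v` is Lipschitz, and the
weak equation extends to Lipschitz test functions by truncating their values near `0`, because
the gradient of `v` vanishes almost everywhere on `{v = 0}`. Stability of `Ω` under `δ_{-t}`
follows from Gronwall's inequality for a defining function along the orbits of `δ_t`: its
derivative is nonnegative on `∂Ω`, hence at least `-C |ρ|` nearby.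
-/

namespace Grushin

open Filter Topology

/-- The slope of `softTrunc n` at `t`: it is `0` for `|t| ≤ 1 / n` and `1` for `|t| ≥ 2 / n`. -/
noncomputable def truncSlope (n : ℕ) (t : ℝ) : ℝ := min 1 (max 0 (n * |t| - 1))

/-- A `C¹` truncation of the identity of `ℝ`: it vanishes near `0`, has slope at most `1`, and
tends to the identity as `n → ∞`. -/
noncomputable def softTrunc (n : ℕ) (s : ℝ) : ℝ := ∫ t in (0 : ℝ)..s, truncSlope n t

theorem continuous_truncSlope (n : ℕ) : Continuous (truncSlope n) := by
  unfold truncSlope; fun_prop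

theorem truncSlope_zero (n : ℕ) : truncSlope n 0 = 0 := by simp [truncSlope]

theorem abs_truncSlope_le_one (n : ℕ) (t : ℝ) : |truncSlope n t| ≤ 1 := by
  have h_nonneg : 0 ≤ truncSlope n t := le_min zero_le_one (le_max_left _ _)
  exact (abs_of_nonneg h_nonneg).trans_le (min_le_left _ _)

theorem tendsto_truncSlope {t : ℝ} (ht : t ≠ 0) :
    Tendsto (fun n => truncSlope n t) atTop (𝓝 1) := by
  have h_large : ∀ᶠ n : ℕ in atTop, 2 ≤ n * |t| :=
    (tendsto_natCast_atTop_atTop.atTop_mul_const (abs_pos.2 ht)).eventually_ge_atTop 2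
  refine tendsto_const_nhds.congr' (h_large.mono fun n hn => ?_)
  exact (min_eq_left ((by linarith : (1 : ℝ) ≤ n * |t| - 1).trans (le_max_right _ _))).symm

theorem hasDerivAt_softTrunc (n : ℕ) (s : ℝ) : HasDerivAt (softTrunc n) (truncSlope n s) s :=
  (continuous_truncSlope n).integral_hasStrictDerivAt 0 s |>.hasDerivAt

theorem contDiff_softTrunc (n : ℕ) : ContDiff ℝ 1 (softTrunc n) := by
  have h_deriv : deriv (softTrunc n) = truncSlope n :=
    funext fun s => (hasDerivAt_softTrunc n s).deriv
  exact contDiff_one_iff_deriv.2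
    ⟨fun s => (hasDerivAt_softTrunc n s).differentiableAt, h_deriv ▸ continuous_truncSlope n⟩

theorem softTrunc_eventuallyEq_zero (n : ℕ) : softTrunc n =ᶠ[𝓝 0] 0 := by
  have h_slope : ∀ᶠ t : ℝ in 𝓝 0, (n : ℝ) * |t| < 1 :=
    (continuous_const.mul continuous_abs).continuousAt.eventually_lt_const (by simp)
  obtain ⟨ε, hε, h_ball⟩ := Metric.eventually_nhds_iff.1 h_slope
  filter_upwards [Metric.ball_mem_nhds 0 hε] with s hs
  refine intervalIntegral.integral_zero_ae (ae_of_all _ fun t ht => ?_)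
  have h_lt : n * |t| < 1 := h_ball <| by
    simpa using (abs_sub_left_of_mem_uIcc (uIoc_subset_uIcc ht)).trans_lt (by simpa using hs)
  simp only [truncSlope]
  rw [max_eq_left (by linarith), min_eq_right zero_le_one]

theorem abs_softTrunc_le (n : ℕ) (s : ℝ) : |softTrunc n s| ≤ |s| := by
  have h_bound := intervalIntegral.norm_integral_le_of_norm_le_const (a := 0) (b := s) (C := 1)
    fun t _ => (Real.norm_eq_abs _).trans_le (abs_truncSlope_le_one n t)
  simpa [softTrunc] using h_bound

theorem tendsto_softTrunc (s : ℝ) : Tendsto (fun n => softTrunc n s) atTop (𝓝 s) := by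
  have h_lim : Tendsto (fun n => softTrunc n s) atTop (𝓝 (∫ _ in (0 : ℝ)..s, (1 : ℝ))) := by
    refine intervalIntegral.tendsto_integral_filter_of_dominated_convergence (fun _ => 1)
      (.of_forall fun n => (continuous_truncSlope n).aestronglyMeasurable)
      (.of_forall fun n => ae_of_all _ fun t _ => abs_truncSlope_le_one n t)
      intervalIntegrable_const ?_
    filter_upwards [Measure.ae_ne volume 0] with t ht _ using tendsto_truncSlope ht
  simpa using h_lim

/-- `v` is the extension by zero of a function of class `C¹` on `O` that vanishes continuously on
the boundary of `O`. It need not be differentiable at the boundary points. -/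
structure IsC1ExtensionByZero {E : Type*} [NormedAddCommGroup E] [NormedSpace ℝ E] (O : Opens E)
    (v : E → ℝ) : Prop where
  continuous : Continuous v
  contDiffOn : ContDiffOn ℝ 1 v O
  eq_zero_of_notMem : ∀ z ∉ O, v z = 0

namespace IsC1ExtensionByZero

variable {E : Type*} [NormedAddCommGroup E] [NormedSpace ℝ E] {O : Opens E} {v : E → ℝ}
  {η : ℝ → ℝ}

theorem differentiableAt (hv : IsC1ExtensionByZero O v) {z : E} (hz : z ∈ O) :
    DifferentiableAt ℝ v z :=
  (hv.contDiffOn.contDiffAt (O.isOpen.mem_nhds hz)).differentiableAt one_ne_zero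

theorem comp_eventuallyEq_zero (hv : IsC1ExtensionByZero O v) (hη : η =ᶠ[𝓝 0] 0) {z : E}
    (hz : z ∉ O) : η ∘ v =ᶠ[𝓝 z] 0 :=
  (hv.continuous.tendsto' z 0 (hv.eq_zero_of_notMem z hz)).eventually hη

theorem tsupport_comp_subset (hv : IsC1ExtensionByZero O v) (hη : η =ᶠ[𝓝 0] 0) :
    tsupport (η ∘ v) ⊆ O := fun z hz => by
  by_contra hzO
  exact notMem_tsupport_iff_eventuallyEq.2 (hv.comp_eventuallyEq_zero hη hzO) hz

theorem contDiff_comp (hv : IsC1ExtensionByZero O v) (hη1 : ContDiff ℝ 1 η) (hη : η =ᶠ[𝓝 0] 0) :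
    ContDiff ℝ 1 (η ∘ v) := contDiff_iff_contDiffAt.2 fun z => by
  by_cases hz : z ∈ O
  · exact hη1.contDiffAt.comp z (hv.contDiffOn.contDiffAt (O.isOpen.mem_nhds hz))
  · exact contDiffAt_const.congr_of_eventuallyEq (hv.comp_eventuallyEq_zero hη hz)

theorem fderiv_comp (hv : IsC1ExtensionByZero O v) (hηd : Differentiable ℝ η) (hη : η =ᶠ[𝓝 0] 0)
    (z : E) : fderiv ℝ (η ∘ v) z = deriv η (v z) • fderiv ℝ v z := by
  by_cases hz : z ∈ O
  · exact ((hηd _).hasDerivAt.comp_hasFDerivAt z (hv.differentiableAt hz).hasFDerivAt).fderiv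
  · have h_deriv : deriv η 0 = 0 := by rw [hη.deriv_eq]; exact deriv_const 0 0
    rw [(hv.comp_eventuallyEq_zero hη hz).fderiv_eq, hv.eq_zero_of_notMem z hz, h_deriv, zero_smul]
    exact fderiv_const_apply 0

theorem fderiv_softTrunc_comp (hv : IsC1ExtensionByZero O v) (n : ℕ) (z : E) :
    fderiv ℝ (softTrunc n ∘ v) z = truncSlope n (v z) • fderiv ℝ v z := by
  rw [hv.fderiv_comp ((contDiff_softTrunc n).differentiable one_ne_zero)
    (softTrunc_eventuallyEq_zero n), (hasDerivAt_softTrunc n _).deriv]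

theorem contDiff_softTrunc_comp (hv : IsC1ExtensionByZero O v) (n : ℕ) :
    ContDiff ℝ 1 (softTrunc n ∘ v) :=
  hv.contDiff_comp (contDiff_softTrunc n) (softTrunc_eventuallyEq_zero n)

theorem lipschitzWith (hv : IsC1ExtensionByZero O v) {C : NNReal}
    (hC : ∀ z ∈ O, ‖fderiv ℝ v z‖ ≤ C) : LipschitzWith C v := by
  have h_trunc (n : ℕ) : LipschitzWith C (softTrunc n ∘ v) := by
    refine lipschitzWith_of_nnnorm_fderiv_le
      ((hv.contDiff_softTrunc_comp n).differentiable one_ne_zero) fun z => ?_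
    rw [hv.fderiv_softTrunc_comp, ← NNReal.coe_le_coe, coe_nnnorm, norm_smul, Real.norm_eq_abs]
    by_cases hz : z ∈ O
    · exact (mul_le_of_le_one_left (norm_nonneg _) (abs_truncSlope_le_one n _)).trans (hC z hz)
    · simp [hv.eq_zero_of_notMem z hz, truncSlope_zero]
  refine LipschitzWith.of_dist_le_mul fun x y => ?_
  exact le_of_tendsto ((tendsto_softTrunc (v x)).dist (tendsto_softTrunc (v y)))
    (.of_forall fun n => (h_trunc n).dist_le_mul x y)

theorem comp_continuousLinearEquiv (hv : IsC1ExtensionByZero O v) (A : E ≃L[ℝ] E) :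
    IsC1ExtensionByZero (Opens.comap ⟨A, A.continuous⟩ O) (v ∘ A) where
  continuous := hv.continuous.comp A.continuous
  contDiffOn := hv.contDiffOn.comp A.contDiff.contDiffOn fun _ hz => hz
  eq_zero_of_notMem _ hz := hv.eq_zero_of_notMem _ hz

end IsC1ExtensionByZero

section WeakDivergence

variable {E : Type*} [NormedAddCommGroup E] [NormedSpace ℝ E]

/-- `div B = g` on `Ω` in the sense of distributions. -/
def HasWeakDivergence [MeasurableSpace E] (μ : Measure E) (Ω : Opens E) (B : E → E) (g : E → ℝ) :
    Prop :=
  ∀ φ : 𝓓(Ω, ℝ), ∫ z, fderiv ℝ φ z (B z) ∂μ = -∫ z, g z * φ z ∂μ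

theorem HasWeakDivergence.congr [MeasurableSpace E] {μ : Measure E} {Ω : Opens E} {B B' : E → E}
    {g g' : E → ℝ} (h : HasWeakDivergence μ Ω B g) (hB : EqOn B B' Ω) (hg : EqOn g g' Ω) :
    HasWeakDivergence μ Ω B' g' := fun φ => by
  have h_notMem {z : E} (hz : z ∉ Ω) : z ∉ tsupport φ := fun h => hz (φ.tsupport_subset h)
  have hB_eq : (fun z => fderiv ℝ φ z (B' z)) = fun z => fderiv ℝ φ z (B z) := by
    ext z
    by_cases hz : z ∈ Ω
    · rw [hB hz]
    · simp [fderiv_of_notMem_tsupport ℝ (h_notMem hz)]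
  have hg_eq : (fun z => g' z * φ z) = fun z => g z * φ z := by
    ext z
    by_cases hz : z ∈ Ω
    · rw [hg hz]
    · simp [image_eq_zero_of_notMem_tsupport (h_notMem hz)]
  rw [hB_eq, hg_eq, h φ]

variable [FiniteDimensional ℝ E] {Ω : Opens E}

theorem exists_testFunction_forall_dist_le {φ : E → ℝ} (hφ : ContDiff ℝ 1 φ)
    (hφ_supp : HasCompactSupport φ) (hφΩ : tsupport φ ⊆ Ω) {ε : ℝ} (hε : 0 < ε) :
    ∃ χ : 𝓓(Ω, ℝ), ∀ z, dist (χ z) (φ z) ≤ ε ∧ dist (fderiv ℝ χ z) (fderiv ℝ φ z) ≤ ε := by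
  borelize E
  have h_fderiv_cont : Continuous (fderiv ℝ φ) := hφ.continuous_fderiv one_ne_zero
  obtain ⟨δ₀, hδ₀, h_thick⟩ := hφ_supp.isCompact.exists_cthickening_subset_open Ω.isOpen hφΩ
  obtain ⟨δ₁, hδ₁, h_unif⟩ := Metric.uniformContinuous_iff.1
    (hφ_supp.uniformContinuous_of_continuous hφ.continuous) ε hε
  obtain ⟨δ₂, hδ₂, h_unif'⟩ := Metric.uniformContinuous_iff.1
    ((hφ_supp.fderiv ℝ).uniformContinuous_of_continuous h_fderiv_cont) ε hε
  obtain ⟨δ, hδ, h_min⟩ := exists_between (lt_min hδ₀ (lt_min hδ₁ hδ₂))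
  simp only [lt_min_iff] at h_min
  let ν : Measure E := Measure.addHaar
  let ρ : ContDiffBump (0 : E) := ⟨δ / 2, δ, half_pos hδ, half_lt_self hδ⟩
  have hρ_int : LocallyIntegrable (ρ.normed ν) ν := ρ.continuous_normed.locallyIntegrable
  let L := ContinuousLinearMap.lsmul ℝ (E := ℝ) ℝ
  let χ : E → ℝ := convolution (ρ.normed ν) φ L ν
  have h_fderiv (z : E) : fderiv ℝ χ z = convolution (ρ.normed ν) (fderiv ℝ φ)
      (ContinuousLinearMap.lsmul ℝ (E := E →L[ℝ] ℝ) ℝ) ν z :=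
    (hφ_supp.hasFDerivAt_convolution_right L hρ_int hφ z).fderiv
  have h_support : tsupport χ ⊆ Ω := by
    refine (closure_minimal ?_ Metric.isClosed_cthickening).trans h_thick
    refine (support_convolution_subset L).trans ?_
    rintro _ ⟨a, ha, b, hb, rfl⟩
    rw [ρ.support_normed_eq] at ha
    refine Metric.mem_cthickening_of_dist_le _ b _ _ (subset_tsupport _ hb) ?_
    simpa [dist_eq_norm] using (mem_ball_zero_iff.1 ha).le.trans h_min.1.le
  refine ⟨⟨χ, ρ.hasCompactSupport_normed.contDiff_convolution_left L ρ.contDiff_normed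
    hφ.continuous.locallyIntegrable, ρ.hasCompactSupport_normed.convolution L hφ_supp, h_support⟩,
    fun z => ⟨?_, ?_⟩⟩
  · exact ρ.dist_normed_convolution_le hφ.continuous.aestronglyMeasurable
      fun x hx => (h_unif ((Metric.mem_ball.1 hx).trans h_min.2.1)).le
  · exact (congrArg (dist · _) (h_fderiv z)).trans_le <|
      ρ.dist_normed_convolution_le h_fderiv_cont.aestronglyMeasurable
        fun x hx => (h_unif' ((Metric.mem_ball.1 hx).trans h_min.2.2)).le

variable [MeasurableSpace E] [BorelSpace E] {μ : Measure E} {B : E → E} {g : E → ℝ}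

theorem integral_fderiv_apply_eq_of_tendsto (hB : Integrable B μ)
    (hg : Integrable g μ) {φ : ℕ → E → ℝ} {ψ : E → ℝ} {C : ℝ} (hφ : ∀ n, ContDiff ℝ 1 (φ n))
    (h_eq : ∀ n, ∫ z, fderiv ℝ (φ n) z (B z) ∂μ = -∫ z, g z * φ n z ∂μ)
    (h_bound : ∀ n z, |φ n z| ≤ C) (h_fderiv_bound : ∀ n z, ‖fderiv ℝ (φ n) z‖ ≤ C)
    (h_lim : ∀ z, Tendsto (fun n => φ n z) atTop (𝓝 (ψ z)))
    (h_fderiv_lim : ∀ᵐ z ∂μ, Tendsto (fun n => fderiv ℝ (φ n) z) atTop (𝓝 (fderiv ℝ ψ z))) :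
    ∫ z, fderiv ℝ ψ z (B z) ∂μ = -∫ z, g z * ψ z ∂μ := by
  have h_left : Tendsto (fun n => ∫ z, fderiv ℝ (φ n) z (B z) ∂μ) atTop
      (𝓝 (∫ z, fderiv ℝ ψ z (B z) ∂μ)) := by
    refine tendsto_integral_of_dominated_convergence (fun z => C * ‖B z‖) (fun n => ?_)
      (hB.norm.const_mul C) (fun n => ae_of_all _ fun z => ?_) ?_
    · exact isBoundedBilinearMap_apply.continuous.comp_aestronglyMeasurable
        (((hφ n).continuous_fderiv one_ne_zero).aestronglyMeasurable.prodMk hB.1)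
    · exact (fderiv ℝ (φ n) z).le_of_opNorm_le (h_fderiv_bound n z) (B z)
    · filter_upwards [h_fderiv_lim] with z hz
      exact ((ContinuousLinearMap.apply ℝ ℝ (B z)).continuous.tendsto _).comp hz
  have h_right : Tendsto (fun n => -∫ z, g z * φ n z ∂μ) atTop (𝓝 (-∫ z, g z * ψ z ∂μ)) := by
    refine (tendsto_integral_of_dominated_convergence (fun z => ‖g z‖ * C)
      (fun n => hg.1.mul (hφ n).continuous.aestronglyMeasurable)
      (hg.norm.mul_const C) (fun n => ae_of_all _ fun z => ?_)
      (ae_of_all _ fun z => tendsto_const_nhds.mul (h_lim z))).neg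
    exact (norm_mul_le _ _).trans (mul_le_mul_of_nonneg_left (h_bound n z) (norm_nonneg _))
  exact tendsto_nhds_unique (h_left.congr h_eq) h_right

theorem HasWeakDivergence.integral_fderiv_apply_of_contDiff (h : HasWeakDivergence μ Ω B g)
    (hB : Integrable B μ) (hg : Integrable g μ) {φ : E → ℝ} (hφ : ContDiff ℝ 1 φ)
    (hφ_supp : HasCompactSupport φ) (hφΩ : tsupport φ ⊆ Ω) :
    ∫ z, fderiv ℝ φ z (B z) ∂μ = -∫ z, g z * φ z ∂μ := by
  choose χ hχ using fun n : ℕ => exists_testFunction_forall_dist_le hφ hφ_supp hφΩ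
    (Nat.one_div_pos_of_nat (α := ℝ) (n := n))
  obtain ⟨C, hC⟩ := hφ_supp.exists_bound_of_continuous hφ.continuous
  obtain ⟨C', hC'⟩ := (hφ_supp.fderiv ℝ).exists_bound_of_continuous
    (hφ.continuous_fderiv one_ne_zero)
  have h_le_one (n : ℕ) : 1 / ((n : ℝ) + 1) ≤ 1 := (div_le_one (by positivity)).2 (by simp)
  refine integral_fderiv_apply_eq_of_tendsto (φ := fun n => χ n) (C := max C C' + 1) hB hg
    (fun n => (χ n).contDiff.of_le (mod_cast le_top)) (fun n => h (χ n)) (fun n z => ?_)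
    (fun n z => ?_) (fun z => ?_) (ae_of_all _ fun z => ?_)
  · exact (norm_le_norm_add_const_of_dist_le (hχ n z).1).trans
      (add_le_add ((hC z).trans (le_max_left _ _)) (h_le_one n))
  · exact (norm_le_norm_add_const_of_dist_le (hχ n z).2).trans
      (add_le_add ((hC' z).trans (le_max_right _ _)) (h_le_one n))
  · exact tendsto_iff_dist_tendsto_zero.2 <| squeeze_zero (fun _ => dist_nonneg)
      (fun n => (hχ n z).1) tendsto_one_div_add_atTop_nhds_zero_nat
  · exact tendsto_iff_dist_tendsto_zero.2 <| squeeze_zero (fun _ => dist_nonneg)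
      (fun n => (hχ n z).2) tendsto_one_div_add_atTop_nhds_zero_nat

variable [μ.IsAddHaarMeasure]

variable (μ) in
/-- Along a line in direction `e`, a zero of `v` at which `∂ₑv ≠ 0` is isolated, so that the
exceptional points of each line form a countable set. -/
theorem ae_fderiv_apply_eq_zero_of_eq_zero {v : E → ℝ} (hv : Continuous v) (e : E) :
    ∀ᵐ z ∂μ, v z = 0 → fderiv ℝ v z e = 0 := by
  have h_meas : MeasurableSet {z | v z = 0 → fderiv ℝ v z e = 0} :=
    (measurableSet_eq_fun hv.measurable measurable_const).imp
      (measurableSet_eq_fun (measurable_fderiv_apply_const ℝ v e) measurable_const)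
  refine ae_mem_of_ae_add_linearMap_mem (LinearMap.toSpanSingleton ℝ E e) volume μ h_meas
    fun y => ?_
  let exceptional : Set ℝ := {x | ¬(v (y + x • e) = 0 → fderiv ℝ v (y + x • e) e = 0)}
  have h_discrete : DiscreteTopology exceptional := by
    refine discreteTopology_subtype_iff.2 fun x hx => ?_
    obtain ⟨-, h_ne⟩ := Classical.not_imp.1 hx
    have h_diff : DifferentiableAt ℝ v (y + x • e) := by
      by_contra h
      simp [fderiv_zero_of_not_differentiableAt h] at h_ne
    have h_line : HasDerivAt (fun x : ℝ => y + x • e) e x := by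
      simpa using ((hasDerivAt_id x).smul_const e).const_add y
    have h_isolated := (h_diff.hasFDerivAt.comp_hasDerivAt x h_line).eventually_ne (c := 0) h_ne
    rw [← disjoint_iff, disjoint_principal_right]
    filter_upwards [h_isolated] with t ht h_mem using ht (Classical.not_imp.1 h_mem).1
  have h_countable : exceptional.Countable :=
    countable_coe_iff.1 (separableSpace_iff_countable.1 inferInstance)
  filter_upwards [h_countable.ae_notMem volume] with x hx using not_not.1 hx

variable (μ) in
theorem ae_fderiv_eq_zero_of_eq_zero {v : E → ℝ} (hv : Continuous v) :
    ∀ᵐ z ∂μ, v z = 0 → fderiv ℝ v z = 0 := by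
  let b := Module.finBasis ℝ E
  filter_upwards [ae_all_iff.2 fun i => ae_fderiv_apply_eq_zero_of_eq_zero μ hv (b i)] with z hz h0
  exact ContinuousLinearMap.coe_injective (b.ext fun i => hz i h0)

theorem HasWeakDivergence.integral_fderiv_apply (h : HasWeakDivergence μ Ω B g)
    (hB : Integrable B μ) (hg : Integrable g μ) {O : Opens E} (hO : O ≤ Ω) {v : E → ℝ}
    (hv : IsC1ExtensionByZero O v) {K : NNReal} (hvK : LipschitzWith K v)
    (hv_supp : HasCompactSupport v) :
    ∫ z, fderiv ℝ v z (B z) ∂μ = -∫ z, g z * v z ∂μ := by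
  obtain ⟨C, hC⟩ := hv_supp.exists_bound_of_continuous hv.continuous
  refine integral_fderiv_apply_eq_of_tendsto (φ := fun n => softTrunc n ∘ v) (C := max C K) hB hg
    hv.contDiff_softTrunc_comp (fun n => ?_) (fun n z => ?_) (fun n z => ?_)
    (fun z => tendsto_softTrunc (v z)) ?_
  · exact h.integral_fderiv_apply_of_contDiff hB hg (hv.contDiff_softTrunc_comp n)
      (hv_supp.comp_left (softTrunc_eventuallyEq_zero n).self_of_nhds)
      ((hv.tsupport_comp_subset (softTrunc_eventuallyEq_zero n)).trans hO)
  · exact ((abs_softTrunc_le n _).trans (hC z)).trans (le_max_left _ _)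
  · rw [hv.fderiv_softTrunc_comp, norm_smul]
    exact ((mul_le_of_le_one_left (norm_nonneg _) (abs_truncSlope_le_one n _)).trans
      (norm_fderiv_le_of_lipschitz ℝ hvK)).trans (le_max_right _ _)
  · filter_upwards [ae_fderiv_eq_zero_of_eq_zero μ hv.continuous] with z hz
    simp only [hv.fderiv_softTrunc_comp]
    rcases eq_or_ne (v z) 0 with h0 | h0
    · simp [hz h0]
    · simpa using (tendsto_truncSlope h0).smul_const (fderiv ℝ v z)

end WeakDivergence

section IntegrationByParts

variable {E : Type*} [NormedAddCommGroup E] [MeasurableSpace E] [BorelSpace E]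
  {μ : Measure E} {Ω : Opens E} {u ψ w : E → ℝ}

theorem integrable_mul_of_tsupport_subset [IsFiniteMeasureOnCompacts μ] (hu : ContinuousOn u Ω)
    (hψ : Continuous ψ) (hψ_supp : HasCompactSupport ψ) (hψΩ : tsupport ψ ⊆ Ω) :
    Integrable (fun z => u z * ψ z) μ := by
  have h_on : IntegrableOn (fun z => u z * ψ z) (tsupport ψ) μ :=
    ((hu.mono hψΩ).mul hψ.continuousOn).integrableOn_compact hψ_supp.isCompact
  exact (integrableOn_iff_integrable_of_support_subset
    ((Function.support_mul_subset_right u ψ).trans (subset_tsupport ψ))).1 h_on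

theorem integral_mul_fderiv_apply_eq_neg [NormedSpace ℝ E] [FiniteDimensional ℝ E]
    [μ.IsAddHaarMeasure] {e : E}
    (hw : Continuous w) (hwe : ∀ z (t : ℝ), w (z + t • e) = w z) (hu : ContDiffOn ℝ 1 u Ω)
    (hψ : ContDiff ℝ 1 ψ) (hψ_supp : HasCompactSupport ψ) (hψΩ : tsupport ψ ⊆ Ω) :
    ∫ z, w z * u z * fderiv ℝ ψ z e ∂μ = -∫ z, w z * fderiv ℝ u z e * ψ z ∂μ := by
  have hψ' : Continuous fun z => fderiv ℝ ψ z e :=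
    (hψ.continuous_fderiv one_ne_zero).clm_apply continuous_const
  have hu' : ContinuousOn (fun z => fderiv ℝ u z e) Ω :=
    (hu.continuousOn_fderiv_of_isOpen Ω.isOpen le_rfl).clm_apply continuousOn_const
  refine integral_bilinear_hasLineDerivAt_right_eq_neg_left_of_integrable
    (f := fun z => w z * u z) (f' := fun z => w z * fderiv ℝ u z e) (v := e)
    (B := ContinuousLinearMap.mul ℝ ℝ) ?_ ?_ ?_ (fun z hz => ?_) fun z _ => ?_
  · exact integrable_mul_of_tsupport_subset (hw.continuousOn.mul hu') hψ.continuous hψ_supp hψΩ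
  · exact integrable_mul_of_tsupport_subset (hw.continuousOn.mul hu.continuousOn) hψ'
      (hψ_supp.fderiv_apply ℝ e) ((tsupport_fderiv_apply_subset ℝ e).trans hψΩ)
  · exact integrable_mul_of_tsupport_subset (hw.continuousOn.mul hu.continuousOn) hψ.continuous
      hψ_supp hψΩ
  · have hu_line : HasLineDerivAt ℝ u (fderiv ℝ u z e) z e :=
      ((hu.contDiffAt (Ω.isOpen.mem_nhds (hψΩ hz))).differentiableAt
        one_ne_zero).hasFDerivAt.hasLineDerivAt e
    unfold HasLineDerivAt at hu_line ⊢
    simpa only [hwe] using hu_line.const_mul (w z)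
  · exact (hψ.differentiable one_ne_zero z).hasFDerivAt.hasLineDerivAt e

end IntegrationByParts

section Dilation

variable {ι : Type*}

/-- The dilations `z ↦ (exp (aᵢ t) zᵢ)ᵢ` of `ℝ^ι` with exponents `a`, parametrised so that they form
a one-parameter group in `t`. -/
noncomputable def dilation (a : ι → ℝ) (t : ℝ) : EuclideanSpace ℝ ι ≃L[ℝ] EuclideanSpace ℝ ι :=
  (PiLp.continuousLinearEquiv 2 ℝ fun _ => ℝ).trans <|
    (ContinuousLinearEquiv.piCongrRight fun i => ContinuousLinearEquiv.unitsEquivAut ℝ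
      (Units.mk0 (Real.exp (a i * t)) (Real.exp_ne_zero _))).trans
    (PiLp.continuousLinearEquiv 2 ℝ fun _ => ℝ).symm

/-- The infinitesimal generator `z ↦ (aᵢ zᵢ)ᵢ` of the dilations `dilation a`. -/
noncomputable def dilationGenerator (a : ι → ℝ) : EuclideanSpace ℝ ι →L[ℝ] EuclideanSpace ℝ ι :=
  (PiLp.continuousLinearEquiv 2 ℝ fun _ => ℝ).symm.toContinuousLinearMap ∘L
    ContinuousLinearMap.pi fun i => a i • EuclideanSpace.proj i

theorem dilation_apply (a : ι → ℝ) (t : ℝ) (z : EuclideanSpace ℝ ι) (i : ι) :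
    dilation a t z i = Real.exp (a i * t) * z i := mul_comm _ _

theorem dilationGenerator_apply (a : ι → ℝ) (z : EuclideanSpace ℝ ι) (i : ι) :
    dilationGenerator a z i = a i * z i := rfl

theorem dilation_zero (a : ι → ℝ) (z : EuclideanSpace ℝ ι) : dilation a 0 z = z := by
  ext i; simp [dilation_apply]

variable [Fintype ι]

theorem hasDerivAt_dilation (a : ι → ℝ) (z : EuclideanSpace ℝ ι) (t : ℝ) :
    HasDerivAt (fun t => dilation a t z) (dilationGenerator a (dilation a t z)) t := by
  have h_coord : HasDerivAt (fun t i => dilation a t z i)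
      (fun i => dilationGenerator a (dilation a t z) i) t := hasDerivAt_pi.2 fun i => by
    simp only [dilation_apply, dilationGenerator_apply]
    exact (((hasDerivAt_id t).const_mul (a i)).exp.mul_const (z i)).congr_deriv
      (by simp only [id_eq, mul_one]; ring)
  exact (PiLp.continuousLinearEquiv 2 ℝ fun _ => ℝ).symm.hasFDerivAt.comp_hasDerivAt t h_coord

theorem norm_dilation_sub_self_le {a : ι → ℝ} {t : ℝ} (hat : ‖a‖ * |t| ≤ 1)
    (z : EuclideanSpace ℝ ι) : ‖dilation a t z - z‖ ≤ 2 * ‖a‖ * |t| * ‖z‖ := by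
  have h_coord (i : ι) : |(dilation a t z - z) i| ≤ 2 * ‖a‖ * |t| * |z i| := by
    have h_le : |a i * t| ≤ ‖a‖ * |t| :=
      (abs_mul _ _).trans_le (mul_le_mul_of_nonneg_right (norm_le_pi_norm a i) (abs_nonneg t))
    have h_exp : |Real.exp (a i * t) - 1| ≤ 2 * ‖a‖ * |t| :=
      (Real.abs_exp_sub_one_le (h_le.trans hat)).trans (by linarith)
    calc |(dilation a t z - z) i| = |Real.exp (a i * t) - 1| * |z i| := by
          rw [← abs_mul, PiLp.sub_apply, dilation_apply, sub_one_mul]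
      _ ≤ 2 * ‖a‖ * |t| * |z i| := mul_le_mul_of_nonneg_right h_exp (abs_nonneg _)
  have h_bound : 0 ≤ 2 * ‖a‖ * |t| := by positivity
  refine le_of_sq_le_sq ?_ (by positivity)
  rw [mul_pow, EuclideanSpace.real_norm_sq_eq, EuclideanSpace.real_norm_sq_eq, Finset.mul_sum]
  refine Finset.sum_le_sum fun i _ => ?_
  rw [← mul_pow, sq_le_sq, abs_mul, abs_of_nonneg h_bound]
  exact h_coord i

theorem integral_comp_dilation (a : ι → ℝ) (t : ℝ) (h : EuclideanSpace ℝ ι → ℝ) :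
    ∫ z, h (dilation a t z) = Real.exp (-((∑ i, a i) * t)) * ∫ z, h z := by
  classical
  have h_matrix : (dilation a t : EuclideanSpace ℝ ι →ₗ[ℝ] EuclideanSpace ℝ ι) =
      Matrix.toLpLin 2 2 (Matrix.diagonal fun i => Real.exp (a i * t)) := by
    ext z i
    simp [dilation_apply, Matrix.mulVec_diagonal]
  have h_det : LinearMap.det (dilation a t : EuclideanSpace ℝ ι →ₗ[ℝ] EuclideanSpace ℝ ι) =
      Real.exp ((∑ i, a i) * t) := by
    rw [h_matrix, LinearMap.det_toLpLin, Matrix.det_diagonal, ← Real.exp_sum, Finset.sum_mul]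
  have h_map : Measure.map (dilation a t) volume =
      ENNReal.ofReal (Real.exp (-((∑ i, a i) * t))) • (volume : Measure (EuclideanSpace ℝ ι)) := by
    have h := Measure.map_linearMap_addHaar_eq_smul_addHaar
      (volume : Measure (EuclideanSpace ℝ ι)) (h_det.trans_ne (Real.exp_ne_zero _))
    rwa [h_det, ← Real.exp_neg, Real.abs_exp] at h
  have h_embedding : MeasurableEmbedding (dilation a t) :=
    (dilation a t).toHomeomorph.measurableEmbedding
  rw [← h_embedding.integral_map, h_map, integral_smul_measure,
    ENNReal.toReal_ofReal (Real.exp_nonneg _), smul_eq_mul]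

end Dilation

section MetricRegularity

variable {E F : Type*} [NormedAddCommGroup E] [NormedSpace ℝ E] [CompleteSpace E]

/-- The Lyusternik–Graves theorem at a zero of `f`. -/
theorem exists_eventually_exists_zero_dist_le [NormedAddCommGroup F] [NormedSpace ℝ F]
    [CompleteSpace F] {f : E → F} {f' : E →L[ℝ] F} {a : E} (hf : HasStrictFDerivAt f f' a)
    (hf' : f'.range = ⊤) (ha : f a = 0) :
    ∃ C : ℝ, ∀ U ∈ 𝓝 a, ∀ᶠ z in 𝓝 a, ∃ z' ∈ U, f z' = 0 ∧ dist z z' ≤ C * ‖f z‖ := by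
  let f'symm := f'.nonlinearRightInverseOfSurjective hf'
  have h_pos : 0 < f'symm.nnnorm := f'.nonlinearRightInverseOfSurjective_nnnorm_pos hf'
  set c : NNReal := f'symm.nnnorm⁻¹ / 2 with hc
  have hc_pos : 0 < c := by positivity
  have h_sub : (f'symm.nnnorm : ℝ)⁻¹ - c = c := by rw [hc]; push_cast; ring
  obtain ⟨s, hs, h_approx⟩ := hf.approximates_deriv_on_nhds (Or.inr hc_pos)
  refine ⟨(c : ℝ)⁻¹, fun U hU => ?_⟩
  obtain ⟨δ, hδ, h_ball⟩ := Metric.nhds_basis_closedBall.mem_iff.1 (inter_mem hs hU)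
  have h_small : ∀ᶠ z in 𝓝 a, dist z a + (c : ℝ)⁻¹ * ‖f z‖ < δ := by
    have h_cont : ContinuousAt (fun z => dist z a + (c : ℝ)⁻¹ * ‖f z‖) a :=
      (continuous_id.dist continuous_const).continuousAt.add
        (hf.continuousAt.norm.const_mul _)
    exact h_cont.eventually_lt_const (by simpa [ha] using hδ)
  filter_upwards [h_small] with z hz
  have h_sub_ball : Metric.closedBall z ((c : ℝ)⁻¹ * ‖f z‖) ⊆ s ∩ U :=
    (Metric.closedBall_subset_closedBall' (by linarith)).trans h_ball
  obtain ⟨z', hz', hz'0⟩ := h_approx.surjOn_closedBall_of_nonlinearRightInverse f'symm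
    (by positivity) (h_sub_ball.trans inter_subset_left)
    (show (0 : F) ∈ _ by
      rw [h_sub, mul_inv_cancel_left₀ (NNReal.coe_pos.2 hc_pos).ne', Metric.mem_closedBall,
        dist_zero_left])
  exact ⟨z', (h_sub_ball hz').2, hz'0, by rwa [dist_comm]⟩

theorem exists_eventually_neg_mul_abs_le {ρ T : E → ℝ} {ρ' : E →L[ℝ] ℝ} {a : E}
    (hρ : HasStrictFDerivAt ρ ρ' a) (hρ' : ρ' ≠ 0) (ha : ρ a = 0) {K : NNReal} {V : Set E}
    (hV : V ∈ 𝓝 a) (hT : LipschitzOnWith K T V) (hT0 : ∀ᶠ z in 𝓝 a, ρ z = 0 → 0 ≤ T z) :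
    ∃ C, ∀ᶠ z in 𝓝 a, -(C * |ρ z|) ≤ T z := by
  have h_surj : ρ'.range = ⊤ := LinearMap.range_eq_top.2 <|
    LinearMap.surjective (by exact_mod_cast hρ')
  obtain ⟨C, hC⟩ := exists_eventually_exists_zero_dist_le hρ h_surj ha
  refine ⟨K * C, ?_⟩
  filter_upwards [hC _ (inter_mem hV hT0), hV] with z ⟨z', ⟨hz'V, hTz'⟩, hz'0, h_dist⟩ hzV
  have h_lip : |T z - T z'| ≤ K * (C * |ρ z|) :=
    (hT.dist_le_mul z hzV z' hz'V).trans (mul_le_mul_of_nonneg_left h_dist K.2)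
  linarith [neg_abs_le (T z - T z'), hTz' hz'0]

end MetricRegularity

theorem frequently_nonneg_of_neg_mul_abs_le_deriv {r r' : ℝ → ℝ} {K t₀ : ℝ}
    (hr : ∀ᶠ t in 𝓝 t₀, HasDerivAt r (r' t) t) (hr' : ∀ᶠ t in 𝓝 t₀, -(K * |r t|) ≤ r' t)
    (h₀ : r t₀ = 0) : ∃ᶠ t in 𝓝[>] t₀, 0 ≤ r t := by
  by_contra h
  have h_neg : ∀ᶠ t in 𝓝[>] t₀, r t < 0 := by simpa using h
  obtain ⟨b, hb, h_sub⟩ := (mem_nhdsGT_iff_exists_Ioc_subset).1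
    (h_neg.and (nhdsWithin_le_nhds (hr.and hr')))
  have h_all : ∀ t ∈ Icc t₀ b, r t ≤ 0 ∧ HasDerivAt r (r' t) t ∧ -(K * |r t|) ≤ r' t := by
    intro t ht
    rcases ht.1.eq_or_lt with rfl | hlt
    · exact ⟨h₀.le, hr.self_of_nhds, hr'.self_of_nhds⟩
    · exact (h_sub ⟨hlt, ht.2⟩).imp_left le_of_lt
  have h_gronwall := le_gronwallBound_of_liminf_deriv_right_le (f := fun t => -r t)
    (f' := fun t => -r' t) (δ := 0) (K := K) (ε := 0)
    (fun t ht => (h_all t ht).2.1.continuousAt.neg.continuousWithinAt)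
    (fun t ht _ =>
      (h_all t (Ico_subset_Icc_self ht)).2.1.neg.hasDerivWithinAt.liminf_right_slope_le)
    (by simp [h₀]) (fun t ht => by
      obtain ⟨h_le, -, h_bound⟩ := h_all t (Ico_subset_Icc_self ht)
      rw [abs_of_nonpos h_le] at h_bound
      linarith) b (right_mem_Icc.2 hb.le)
  rw [gronwallBound_ε0_δ0] at h_gronwall
  linarith [(h_sub (right_mem_Ioc.2 hb)).1]

theorem mem_of_mem_right_of_frequently_notMem {X : Type*} [TopologicalSpace X] {γ : ℝ → X}
    (hγ : Continuous γ) {Ω : Set X} (hΩ : IsOpen Ω)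
    (h_exit : ∀ t, γ t ∈ frontier Ω → ∃ᶠ s in 𝓝[>] t, γ s ∉ Ω) {a b : ℝ} (hab : a ≤ b)
    (hb : γ b ∈ Ω) : γ a ∈ Ω := by
  by_contra ha
  have h_closed : IsClosed {t | γ t ∉ Ω} := hΩ.isClosed_compl.preimage hγ
  refine (h_closed.inter isClosed_Icc).mem_of_ge_of_forall_exists_gt ha hab (fun t ht => ?_) hb
  have h_freq : ∃ᶠ s in 𝓝[>] t, γ s ∉ Ω := by
    by_cases h_closure : γ t ∈ closure Ω
    · exact h_exit t (hΩ.frontier_eq ▸ ⟨h_closure, ht.1⟩)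
    · have h_ev : ∀ᶠ s in 𝓝[>] t, γ s ∉ closure Ω := nhdsWithin_le_nhds <|
        hγ.continuousAt (isClosed_closure.isOpen_compl.mem_nhds h_closure)
      exact (h_ev.mono fun s hs h => hs (subset_closure h)).frequently
  exact (h_freq.and_eventually (Ioc_mem_nhdsGT ht.2.2)).exists

section Boundary

variable {Ω : Opens Space3} {ζ : Space3} {U : Set Space3} {ρ : Space3 → ℝ}

namespace IsLocalDefiningFunction

theorem contDiffAt (h : IsLocalDefiningFunction Ω ζ U ρ) : ContDiffAt ℝ ∞ ρ ζ :=
  h.smooth.contDiffAt (h.isOpen.mem_nhds h.mem)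

theorem mem_iff (h : IsLocalDefiningFunction Ω ζ U ρ) {z : Space3} (hz : z ∈ U) :
    z ∈ Ω ↔ ρ z < 0 := by
  have h_iff := Set.ext_iff.1 h.inter_eq z
  simpa [hz] using h_iff

theorem mem_frontier_iff (h : IsLocalDefiningFunction Ω ζ U ρ) :
    ζ ∈ frontier (Ω : Set Space3) ↔ ρ ζ = 0 := by
  have hU : ∀ᶠ z in 𝓝 ζ, z ∈ U := h.isOpen.mem_nhds h.mem
  have h_cont : ContinuousAt ρ ζ := h.contDiffAt.continuousAt
  rw [Ω.isOpen.frontier_eq, Set.mem_sdiff, SetLike.mem_coe, h.mem_iff h.mem, not_lt]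
  refine ⟨fun ⟨h_closure, h_nonneg⟩ => h_nonneg.antisymm' ?_, fun h_zero => ⟨?_, h_zero.ge⟩⟩
  · by_contra! h_pos
    obtain ⟨z, hzΩ, hzU, hz⟩ := ((mem_closure_iff_frequently.1 h_closure).and_eventually
      (hU.and (h_cont.eventually_const_lt h_pos))).exists
    exact hz.not_gt ((h.mem_iff hzU).1 hzΩ)
  · by_contra h_notMem
    have h_min : IsLocalMin ρ ζ := by
      filter_upwards [hU, isClosed_closure.isOpen_compl.mem_nhds h_notMem] with z hzU hz
      exact h_zero ▸ not_lt.1 fun h_neg => hz (subset_closure ((h.mem_iff hzU).2 h_neg))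
    exact h.gradient_ne_zero (by rw [gradient, h_min.fderiv_eq_zero, map_zero])

theorem fderiv_ne_zero (h : IsLocalDefiningFunction Ω ζ U ρ) : fderiv ℝ ρ ζ ≠ 0 := fun h0 =>
  h.gradient_ne_zero (by rw [gradient, h0, map_zero])

theorem eventually (h : IsLocalDefiningFunction Ω ζ U ρ) :
    ∀ᶠ z in 𝓝 ζ, IsLocalDefiningFunction Ω z U ρ := by
  have h_fderiv : ∀ᶠ z in 𝓝 ζ, fderiv ℝ ρ z ≠ 0 :=
    (h.contDiffAt.continuousAt_fderiv (by simp)).eventually_ne h.fderiv_ne_zero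
  filter_upwards [h.isOpen.mem_nhds h.mem, h_fderiv] with z hzU hz
  exact ⟨h.isOpen, hzU, h.smooth, h.inter_eq, fun h0 => hz <| by
    simpa [gradient] using h0⟩

end IsLocalDefiningFunction

/-- The exponents of the dilations `(x₁, x₂, y) ↦ (eᵗx₁, eᵗx₂, e^{(1+α)t}y)` adapted to the Grushin
operator. -/
def grushinExponents (α : ℝ) : Fin 3 → ℝ := ![1, 1, 1 + α]

/-- `Ω` is stable under the anisotropic contractions `dilation (grushinExponents α) (-t)`, `0 ≤ t`:
star-shapedness without reference to the boundary. -/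
def IsDilationStarShaped (α : ℝ) (Ω : Set Space3) : Prop :=
  ∀ t, 0 ≤ t → ∀ z, dilation (grushinExponents α) t z ∈ Ω → z ∈ Ω

variable {α : ℝ}

theorem IsStarShaped.fderiv_dilationGenerator_nonneg (hstar : IsStarShaped α Ω)
    (h : IsLocalDefiningFunction Ω ζ U ρ) (hζ : ζ ∈ frontier (Ω : Set Space3)) :
    0 ≤ fderiv ℝ ρ ζ (dilationGenerator (grushinExponents α) ζ) := by
  have h_norm : 0 < ‖gradient ρ ζ‖ := norm_pos_iff.2 h.gradient_ne_zero
  have h_star := hstar.2 ζ hζ _ ⟨U, ρ, h, rfl⟩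
  have h_eq : fderiv ℝ ρ ζ (dilationGenerator (grushinExponents α) ζ) = ‖gradient ρ ζ‖ *
      (ζ 0 * (‖gradient ρ ζ‖⁻¹ • gradient ρ ζ) 0 + ζ 1 * (‖gradient ρ ζ‖⁻¹ • gradient ρ ζ) 1 +
        (1 + α) * ζ 2 * (‖gradient ρ ζ‖⁻¹ • gradient ρ ζ) 2) := by
    rw [← toDual_gradient, InnerProductSpace.toDual_apply_apply, PiLp.inner_apply,
      Fin.sum_univ_three]
    simp only [grushinExponents, dilationGenerator_apply, Matrix.cons_val_zero,
      Matrix.cons_val_one, Matrix.cons_val, one_mul, RCLike.inner_apply, Real.ringHom_apply,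
      PiLp.smul_apply, smul_eq_mul]
    field_simp
  rw [h_eq]
  exact mul_nonneg h_norm.le h_star

theorem IsLocalDefiningFunction.frequently_dilation_notMem (h : IsLocalDefiningFunction Ω ζ U ρ)
    (hstar : IsStarShaped α Ω) (hζ : ζ ∈ frontier (Ω : Set Space3)) {t : ℝ} {z : Space3}
    (hz : dilation (grushinExponents α) t z = ζ) :
    ∃ᶠ s in 𝓝[>] t, dilation (grushinExponents α) s z ∉ Ω := by
  set A := dilationGenerator (grushinExponents α)
  have hγ := hasDerivAt_dilation (grushinExponents α) z
  have hγζ : Tendsto (fun s => dilation (grushinExponents α) s z) (𝓝 t) (𝓝 ζ) :=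
    hz ▸ (hγ t).continuousAt
  have h_lip : ContDiffAt ℝ 1 (fun z => fderiv ℝ ρ z (A z)) ζ :=
    (h.contDiffAt.fderiv_right (m := 1) (by norm_cast)).clm_apply A.contDiff.contDiffAt
  obtain ⟨K, V, hV, hK⟩ := h_lip.exists_lipschitzOnWith
  have h_nonneg : ∀ᶠ z in 𝓝 ζ, ρ z = 0 → 0 ≤ fderiv ℝ ρ z (A z) :=
    h.eventually.mono fun z hz hρz =>
      hstar.fderiv_dilationGenerator_nonneg hz (hz.mem_frontier_iff.2 hρz)
  obtain ⟨C, hC⟩ := exists_eventually_neg_mul_abs_le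
    (h.contDiffAt.hasStrictFDerivAt (by simp)) h.fderiv_ne_zero (h.mem_frontier_iff.1 hζ) hV hK
    h_nonneg
  have h_deriv : ∀ᶠ s in 𝓝 t, HasDerivAt (fun s => ρ (dilation (grushinExponents α) s z))
      (fderiv ℝ ρ (dilation (grushinExponents α) s z) (A (dilation (grushinExponents α) s z))) s :=
    (hγζ.eventually h.eventually).mono fun s hs =>
      (hs.contDiffAt.differentiableAt (by simp)).hasFDerivAt.comp_hasDerivAt s (hγ s)
  have h_freq := frequently_nonneg_of_neg_mul_abs_le_deriv h_deriv (hγζ.eventually hC)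
    (by rw [hz]; exact h.mem_frontier_iff.1 hζ)
  have hU : ∀ᶠ s in 𝓝[>] t, dilation (grushinExponents α) s z ∈ U :=
    nhdsWithin_le_nhds (hγζ (h.isOpen.mem_nhds h.mem))
  exact (h_freq.and_eventually hU).mono fun s hs hsΩ => hs.1.not_gt ((h.mem_iff hs.2).1 hsΩ)

theorem IsStarShaped.isDilationStarShaped (hstar : IsStarShaped α Ω)
    (hΩ : IsBoundedSmoothDomain Ω) : IsDilationStarShaped α Ω := fun t ht z hz => by
  have h_cont : Continuous fun s => dilation (grushinExponents α) s z :=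
    continuous_iff_continuousAt.2 fun s => (hasDerivAt_dilation _ z s).continuousAt
  have h_mem := mem_of_mem_right_of_frequently_notMem h_cont Ω.isOpen (fun s hs => ?_) ht hz
  · rwa [dilation_zero] at h_mem
  · obtain ⟨U, ρ, h⟩ := hΩ.smooth_boundary _ hs
    exact h.frequently_dilation_notMem hstar hs rfl

end Boundary

section Weight

variable {α : ℝ}

theorem weight_nonneg (α : ℝ) (z : Space3) : 0 ≤ weight α z :=
  Real.rpow_nonneg (Real.sqrt_nonneg _) _

theorem weight_pos (α : ℝ) {z : Space3} (hz : z 0 ≠ 0) : 0 < weight α z :=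
  Real.rpow_pos_of_pos (Real.sqrt_pos.2 (by positivity)) _

theorem continuous_weight (hα : 0 ≤ α) : Continuous (weight α) := by
  unfold weight horizontalNorm
  exact Continuous.rpow_const (by fun_prop) fun _ => Or.inr (by positivity)

theorem integrable_weight_mul (hα : 0 ≤ α) {f : Space3 → ℝ} (hf : Continuous f)
    (hf_supp : HasCompactSupport f) : Integrable fun z => weight α z * f z :=
  ((continuous_weight hα).mul hf).integrable_of_hasCompactSupport hf_supp.mul_left

theorem weight_dilation (α t : ℝ) (z : Space3) :
    weight α (dilation (grushinExponents α) t z) = Real.exp (2 * α * t) * weight α z := by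
  have h_norm : horizontalNorm (dilation (grushinExponents α) t z) =
      Real.exp t * horizontalNorm z := by
    rw [horizontalNorm, horizontalNorm, ← Real.sqrt_sq (Real.exp_pos t).le,
      ← Real.sqrt_mul (sq_nonneg _)]
    simp only [grushinExponents, dilation_apply, Matrix.cons_val_zero, Matrix.cons_val_one,
      one_mul]
    ring_nf
  have h_nonneg : 0 ≤ horizontalNorm z := Real.sqrt_nonneg _
  rw [weight, h_norm, Real.mul_rpow (Real.exp_pos t).le h_nonneg, ← Real.exp_mul, weight,
    mul_comm t]

theorem sum_grushinExponents (α : ℝ) : ∑ i, grushinExponents α i = 3 + α := by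
  simp only [grushinExponents, Fin.sum_univ_three, Matrix.cons_val_zero, Matrix.cons_val_one,
    Matrix.cons_val]
  ring

theorem integral_weight_mul_comp_dilation (α t : ℝ) (h : Space3 → ℝ) :
    ∫ z, weight α z * h (dilation (grushinExponents α) t z) =
      Real.exp (-(3 * (1 + α) * t)) * ∫ z, weight α z * h z := by
  calc ∫ z, weight α z * h (dilation (grushinExponents α) t z)
      = ∫ z, Real.exp (-(2 * α * t)) * (weight α (dilation (grushinExponents α) t z) *
          h (dilation (grushinExponents α) t z)) := by
        simp only [weight_dilation, ← mul_assoc, ← Real.exp_add, neg_add_cancel, Real.exp_zero,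
          one_mul]
    _ = Real.exp (-(3 * (1 + α) * t)) * ∫ z, weight α z * h z := by
        rw [integral_const_mul, integral_comp_dilation _ _ fun z => weight α z * h z, ← mul_assoc,
          ← Real.exp_add, sum_grushinExponents]
        ring_nf

/-- The coefficients `1, 1, |x|^{2α}` of the Grushin operator `∂₁² + ∂₂² + |x|^{2α} ∂₃²`. -/
noncomputable def coordWeight (α : ℝ) : Fin 3 → Space3 → ℝ := ![1, 1, weight α]

theorem continuous_coordWeight (hα : 0 ≤ α) (i : Fin 3) : Continuous (coordWeight α i) := by
  fin_cases i
  exacts [continuous_const, continuous_const, continuous_weight hα]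

theorem coordWeight_nonneg (α : ℝ) (i : Fin 3) (z : Space3) : 0 ≤ coordWeight α i z := by
  fin_cases i
  exacts [zero_le_one, zero_le_one, weight_nonneg α z]

theorem coordWeight_add_smul_single (α : ℝ) (i : Fin 3) (z : Space3) (t : ℝ) :
    coordWeight α i (z + t • EuclideanSpace.single i (1 : ℝ)) = coordWeight α i z := by
  fin_cases i <;> simp [coordWeight, weight, horizontalNorm]

theorem coordWeight_dilation (α t : ℝ) (i : Fin 3) (z : Space3) :
    coordWeight α i (dilation (grushinExponents α) t z) =
      Real.exp (2 * (grushinExponents α i - 1) * t) * coordWeight α i z := by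
  fin_cases i
  · simp [coordWeight, grushinExponents]
  · simp [coordWeight, grushinExponents]
  · exact (weight_dilation α t z).trans (by simp [coordWeight, grushinExponents])

end Weight

section Gradient

variable {α : ℝ} {v φ : Space3 → ℝ} {L M : NNReal}

theorem fderiv_apply_eq_sum (v : Space3 → ℝ) (z e : Space3) :
    fderiv ℝ v z e = ∑ i, partialDeriv i v z * e i := by
  have h_basis : e = ∑ i, e i • EuclideanSpace.single i (1 : ℝ) := by
    ext j
    simp [Finset.sum_apply, Pi.single_apply]
  conv_lhs => rw [h_basis]
  simp [map_sum, partialDeriv, mul_comm]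

theorem norm_fderiv_le_sum_abs_partialDeriv (v : Space3 → ℝ) (z : Space3) :
    ‖fderiv ℝ v z‖ ≤ ∑ i, |partialDeriv i v z| := by
  refine ContinuousLinearMap.opNorm_le_bound _ (by positivity) fun e => ?_
  rw [fderiv_apply_eq_sum, Finset.sum_mul]
  refine norm_sum_le_of_le _ fun i _ => ?_
  rw [norm_mul, Real.norm_eq_abs]
  gcongr
  exact PiLp.norm_apply_le e i

theorem abs_partialDeriv_le_of_lipschitzWith (hv : LipschitzWith L v) (i : Fin 3) (z : Space3) :
    |partialDeriv i v z| ≤ L := by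
  simpa [partialDeriv] using (fderiv ℝ v z).le_of_opNorm_le (norm_fderiv_le_of_lipschitz ℝ hv)
    (EuclideanSpace.single i 1)

theorem integrable_mul_partialDeriv {w : Space3 → ℝ} (hw : Continuous w) (hv : LipschitzWith L v)
    (hv_supp : HasCompactSupport v) (i : Fin 3) :
    Integrable fun z => w z * partialDeriv i v z := by
  have h_on : IntegrableOn (fun z => w z * partialDeriv i v z) (tsupport v) :=
    (hw.continuousOn.integrableOn_compact hv_supp.isCompact).mul_bdd
      (measurable_fderiv_apply_const ℝ v _).aestronglyMeasurable
      (.of_forall (abs_partialDeriv_le_of_lipschitzWith hv i))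
  exact (integrableOn_iff_integrable_of_support_subset <|
    (Function.support_mul_subset_right w _).trans <|
      (subset_tsupport _).trans (tsupport_fderiv_apply_subset ℝ _)).1 h_on

theorem partialDeriv_comp_dilation (a : Fin 3 → ℝ) (t : ℝ) (v : Space3 → ℝ) (i : Fin 3)
    (z : Space3) : partialDeriv i (v ∘ dilation a t) z =
      Real.exp (a i * t) * partialDeriv i v (dilation a t z) := by
  have h_single : dilation a t (EuclideanSpace.single i 1) =
      Real.exp (a i * t) • EuclideanSpace.single i (1 : ℝ) := by
    ext j
    by_cases h : j = i
    · subst h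
      simp [dilation_apply]
    · simp [dilation_apply, h]
  rw [partialDeriv, ContinuousLinearEquiv.comp_right_fderiv]
  simp [partialDeriv, h_single]

/-- The vector field `(∂₁v, ∂₂v, |x|^{2α} ∂₃v)`, whose divergence is the Grushin operator applied
to `v`. -/
noncomputable def grushinField (α : ℝ) (v : Space3 → ℝ) (z : Space3) : Space3 :=
  ∑ i, (coordWeight α i z * partialDeriv i v z) • EuclideanSpace.single i 1

/-- The squared Grushin gradient `(∂₁v)² + (∂₂v)² + |x|^{2α} (∂₃v)²`. -/
noncomputable def grushinGradSq (α : ℝ) (v : Space3 → ℝ) (z : Space3) : ℝ :=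
  ∑ i, coordWeight α i z * partialDeriv i v z ^ 2

theorem fderiv_grushinField (α : ℝ) (v φ : Space3 → ℝ) (z : Space3) :
    fderiv ℝ φ z (grushinField α v z) =
      ∑ i, coordWeight α i z * partialDeriv i v z * partialDeriv i φ z := by
  simp [grushinField, map_sum, partialDeriv]

theorem fderiv_grushinField_self (α : ℝ) (v : Space3 → ℝ) (z : Space3) :
    fderiv ℝ v z (grushinField α v z) = grushinGradSq α v z := by
  simp only [fderiv_grushinField, grushinGradSq, sq, mul_assoc]

theorem fderiv_grushinField_le (α : ℝ) (v φ : Space3 → ℝ) (z : Space3) :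
    fderiv ℝ φ z (grushinField α v z) ≤ (grushinGradSq α v z + grushinGradSq α φ z) / 2 := by
  rw [fderiv_grushinField, grushinGradSq, grushinGradSq, ← Finset.sum_add_distrib, Finset.sum_div]
  refine Finset.sum_le_sum fun i _ => ?_
  nlinarith [mul_nonneg (coordWeight_nonneg α i z)
    (sq_nonneg (partialDeriv i v z - partialDeriv i φ z))]

theorem integrable_grushinField (hα : 0 ≤ α) (hv : LipschitzWith L v)
    (hv_supp : HasCompactSupport v) : Integrable (grushinField α v) :=
  integrable_finsetSum _ fun i _ =>
    (integrable_mul_partialDeriv (continuous_coordWeight hα i) hv hv_supp i).smul_const _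

theorem integrable_fderiv_grushinField (hα : 0 ≤ α) (hv : LipschitzWith L v)
    (hv_supp : HasCompactSupport v) (hφ : LipschitzWith M φ) :
    Integrable fun z => fderiv ℝ φ z (grushinField α v z) := by
  simp only [fderiv_grushinField]
  exact integrable_finsetSum _ fun i _ =>
    (integrable_mul_partialDeriv (continuous_coordWeight hα i) hv hv_supp i).mul_bdd
      (measurable_fderiv_apply_const ℝ φ _).aestronglyMeasurable
      (.of_forall (abs_partialDeriv_le_of_lipschitzWith hφ i))

theorem integrable_grushinGradSq (hα : 0 ≤ α) (hv : LipschitzWith L v)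
    (hv_supp : HasCompactSupport v) : Integrable (grushinGradSq α v) := by
  simpa only [fderiv_grushinField_self] using integrable_fderiv_grushinField hα hv hv_supp hv

theorem grushinGradSq_comp_dilation (α t : ℝ) (v : Space3 → ℝ) (z : Space3) :
    grushinGradSq α (v ∘ dilation (grushinExponents α) t) z =
      Real.exp (2 * t) * grushinGradSq α v (dilation (grushinExponents α) t z) := by
  rw [grushinGradSq, grushinGradSq, Finset.mul_sum]
  refine Finset.sum_congr rfl fun i _ => ?_
  rw [partialDeriv_comp_dilation, coordWeight_dilation, mul_pow, ← Real.exp_nat_mul]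
  have h_exp : Real.exp ((2 : ℕ) * (grushinExponents α i * t)) =
      Real.exp (2 * t) * Real.exp (2 * (grushinExponents α i - 1) * t) := by
    rw [← Real.exp_add]
    push_cast
    ring_nf
  rw [h_exp]
  ring

theorem integral_grushinGradSq_comp_dilation (α t : ℝ) (v : Space3 → ℝ) :
    ∫ z, grushinGradSq α (v ∘ dilation (grushinExponents α) t) z =
      Real.exp (-((1 + α) * t)) * ∫ z, grushinGradSq α v z := by
  simp only [grushinGradSq_comp_dilation]
  rw [integral_const_mul, integral_comp_dilation, ← mul_assoc, ← Real.exp_add,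
    sum_grushinExponents]
  ring_nf

end Gradient

section WeakEquation

variable {α : ℝ} {Ω : Opens Space3} {u : Space3 → ℝ} {f : Space3 → ℝ → ℝ}

theorem AreSecondDerivs.isDistribSecondDeriv {g₁ g₂ g₃ : Space3 → ℝ}
    (hg : AreSecondDerivs α Ω u g₁ g₂ g₃) (i : Fin 3) :
    IsDistribSecondDeriv Ω i (fun z => coordWeight α i z * u z) (![g₁, g₂, g₃] i) := by
  fin_cases i
  · simpa [coordWeight] using hg.deriv₁
  · simpa [coordWeight] using hg.deriv₂
  · exact hg.deriv₃

theorem AreSecondDerivs.continuousOn {g₁ g₂ g₃ : Space3 → ℝ}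
    (hg : AreSecondDerivs α Ω u g₁ g₂ g₃) (i : Fin 3) :
    ContinuousOn (![g₁, g₂, g₃] i) (closure Ω) := by
  fin_cases i
  exacts [hg.continuousOn₁, hg.continuousOn₂, hg.continuousOn₃]

theorem setIntegral_mul_eq_integral_of_tsupport_subset {h ψ : Space3 → ℝ}
    (hψ : tsupport ψ ⊆ Ω) : ∫ z in Ω, h z * ψ z = ∫ z, h z * ψ z :=
  setIntegral_eq_integral_of_forall_compl_eq_zero fun z hz => by
    rw [image_eq_zero_of_notMem_tsupport fun h => hz (hψ h), mul_zero]

theorem IsDistribSecondDeriv.integral_mul_partialDeriv {i : Fin 3} {w g : Space3 → ℝ}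
    (hg : IsDistribSecondDeriv Ω i (fun z => w z * u z) g) (hw : Continuous w)
    (hwi : ∀ z (t : ℝ), w (z + t • EuclideanSpace.single i (1 : ℝ)) = w z)
    (hu : ContDiffOn ℝ 1 u Ω) (φ : 𝓓(Ω, ℝ)) :
    ∫ z, w z * partialDeriv i u z * partialDeriv i φ z = -∫ z, g z * φ z := by
  have hφ' : tsupport (partialDeriv i φ) ⊆ Ω :=
    (tsupport_fderiv_apply_subset ℝ _).trans φ.tsupport_subset
  have h_smooth : ContDiff ℝ 1 (partialDeriv i φ) :=
    (φ.contDiff.fderiv_right (m := 1) (by norm_cast)).clm_apply contDiff_const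
  have h_parts := integral_mul_fderiv_apply_eq_neg (μ := volume) hw hwi hu h_smooth
    (φ.hasCompactSupport.fderiv_apply ℝ _) hφ'
  have h_distrib := hg φ
  rw [setIntegral_mul_eq_integral_of_tsupport_subset φ.tsupport_subset,
    setIntegral_mul_eq_integral_of_tsupport_subset
      (show tsupport (partialDeriv i (partialDeriv i φ)) ⊆ Ω from
        (tsupport_fderiv_apply_subset ℝ _).trans hφ')] at h_distrib
  rw [← h_distrib]
  exact (neg_eq_iff_eq_neg.2 h_parts).symm

theorem IsSolution.hasWeakDivergence (hα : 0 ≤ α) (hu : ContDiffOn ℝ 1 u Ω)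
    (hsol : IsSolution α Ω f u) :
    HasWeakDivergence volume Ω (grushinField α u) fun z => -f z (u z) := fun φ => by
  obtain ⟨⟨g₁, g₂, g₃, hg, h_eq⟩, -⟩ := hsol
  have h_int_left (i : Fin 3) :
      Integrable fun z => coordWeight α i z * partialDeriv i u z * partialDeriv i φ z :=
    integrable_mul_of_tsupport_subset
      ((continuous_coordWeight hα i).continuousOn.mul
        ((hu.continuousOn_fderiv_of_isOpen Ω.isOpen le_rfl).clm_apply continuousOn_const))
      ((φ.contDiff.continuous_fderiv (by simp)).clm_apply continuous_const)
      (φ.hasCompactSupport.fderiv_apply ℝ _)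
      ((tsupport_fderiv_apply_subset ℝ _).trans φ.tsupport_subset)
  have h_int_right (i : Fin 3) : Integrable fun z => ![g₁, g₂, g₃] i z * φ z :=
    integrable_mul_of_tsupport_subset ((hg.continuousOn i).mono subset_closure) φ.continuous
      φ.hasCompactSupport φ.tsupport_subset
  have h_sum (z : Space3) (hz : z ∈ Ω) : -f z (u z) = ∑ i, ![g₁, g₂, g₃] i z := by
    rw [← h_eq z hz, Fin.sum_univ_three]
    simp only [Matrix.cons_val_zero, Matrix.cons_val_one, Matrix.cons_val]
    ring
  calc ∫ z, fderiv ℝ φ z (grushinField α u z)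
      = ∑ i, ∫ z, coordWeight α i z * partialDeriv i u z * partialDeriv i φ z := by
        simp only [fderiv_grushinField]
        exact integral_finsetSum _ fun i _ => h_int_left i
    _ = -∫ z, ∑ i, ![g₁, g₂, g₃] i z * φ z := by
        rw [integral_finsetSum _ fun i _ => h_int_right i, ← Finset.sum_neg_distrib]
        exact Finset.sum_congr rfl fun i _ =>
          (hg.isDistribSecondDeriv i).integral_mul_partialDeriv (continuous_coordWeight hα i)
            (coordWeight_add_smul_single α i) hu φ
    _ = -∫ z, -f z (u z) * φ z := by
        congr 1
        simp only [← Finset.sum_mul]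
        rw [← setIntegral_mul_eq_integral_of_tsupport_subset φ.tsupport_subset,
          ← setIntegral_mul_eq_integral_of_tsupport_subset φ.tsupport_subset]
        exact setIntegral_congr_fun Ω.isOpen.measurableSet fun z hz => by simp only [h_sum z hz]

end WeakEquation

section Extension

variable {α : ℝ} {Ω : Opens Space3} {u : Space3 → ℝ}

theorem MemC10.isC1ExtensionByZero_indicator (hu : MemC10 Ω u) :
    IsC1ExtensionByZero Ω ((Ω : Set Space3).indicator u) where
  continuous := continuous_indicator hu.eq_zero_of_mem_frontier hu.continuousOn
  contDiffOn := hu.contDiffOn.congr fun _ hz => indicator_of_mem hz u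
  eq_zero_of_notMem _ hz := indicator_of_notMem hz u

theorem partialDeriv_indicator_of_mem {z : Space3} (hz : z ∈ Ω) (i : Fin 3) :
    partialDeriv i ((Ω : Set Space3).indicator u) z = partialDeriv i u z := by
  have h_eq : (Ω : Set Space3).indicator u =ᶠ[𝓝 z] u := by
    filter_upwards [Ω.isOpen.mem_nhds hz] with w hw using indicator_of_mem hw u
  rw [partialDeriv, partialDeriv, h_eq.fderiv_eq]

theorem grushinField_indicator_of_mem {z : Space3} (hz : z ∈ Ω) :
    grushinField α ((Ω : Set Space3).indicator u) z = grushinField α u z := by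
  simp only [grushinField, partialDeriv_indicator_of_mem hz]

theorem MemC10.exists_lipschitzWith_indicator (hu : MemC10 Ω u)
    (hΩ : Bornology.IsBounded (Ω : Set Space3)) :
    ∃ L : NNReal, LipschitzWith L ((Ω : Set Space3).indicator u) := by
  choose G hG hGu using hu.partialDeriv_extends
  obtain ⟨C, hC⟩ := hΩ.isCompact_closure.exists_bound_of_continuousOn
    (f := fun z => ∑ i, |G i z|) (continuousOn_finsetSum _ fun i _ => (hG i).abs)
  refine ⟨C.toNNReal, hu.isC1ExtensionByZero_indicator.lipschitzWith fun z hz => ?_⟩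
  calc ‖fderiv ℝ ((Ω : Set Space3).indicator u) z‖
      ≤ ∑ i, |partialDeriv i ((Ω : Set Space3).indicator u) z| :=
        norm_fderiv_le_sum_abs_partialDeriv _ _
    _ = ∑ i, |G i z| := Finset.sum_congr rfl fun i _ => by
        rw [partialDeriv_indicator_of_mem hz, hGu i hz]
    _ ≤ C := (le_abs_self _).trans (hC z (subset_closure hz))
    _ ≤ C.toNNReal := Real.le_coe_toNNReal C

end Extension

section Comparison

variable {α : ℝ} {Ω : Opens Space3} {v : Space3 → ℝ} {L : NNReal}

theorem integral_mul_comp_dilation_le (hα : 0 ≤ α) (hΩ : IsDilationStarShaped α Ω)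
    (hv : IsC1ExtensionByZero Ω v) (hvL : LipschitzWith L v) (hv_supp : HasCompactSupport v)
    {F : Space3 → ℝ} (hF : Integrable F)
    (h : HasWeakDivergence volume Ω (grushinField α v) fun z => -F z) {t : ℝ} (ht : 0 ≤ t) :
    ∫ z, F z * v (dilation (grushinExponents α) t z) ≤
      (1 + Real.exp (-((1 + α) * t))) / 2 * ∫ z, F z * v z := by
  set A := dilation (grushinExponents α) t
  have h_field := integrable_grushinField hα hvL hv_supp
  have h_energy : ∫ z, F z * v z = ∫ z, grushinGradSq α v z := by
    simpa [fderiv_grushinField_self, integral_neg] using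
      (h.integral_fderiv_apply h_field hF.neg le_rfl hv hvL hv_supp).symm
  have hvA_L := hvL.comp A.lipschitz
  have hvA_supp : HasCompactSupport (v ∘ A) := hv_supp.comp_homeomorph A.toHomeomorph
  have h_test : ∫ z, F z * v (A z) = ∫ z, fderiv ℝ (v ∘ A) z (grushinField α v z) := by
    simpa [integral_neg] using (h.integral_fderiv_apply h_field hF.neg
      (fun z hz => hΩ t ht z hz) (hv.comp_continuousLinearEquiv A) hvA_L hvA_supp).symm
  have h_int := integrable_grushinGradSq hα hvL hv_supp
  have h_intA := integrable_grushinGradSq hα hvA_L hvA_supp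
  calc ∫ z, F z * v (A z) = ∫ z, fderiv ℝ (v ∘ A) z (grushinField α v z) := h_test
    _ ≤ ∫ z, (grushinGradSq α v z + grushinGradSq α (v ∘ A) z) / 2 :=
        integral_mono (integrable_fderiv_grushinField hα hvL hv_supp hvA_L)
          ((h_int.add h_intA).div_const 2) fun z => fderiv_grushinField_le α v (v ∘ A) z
    _ = (1 + Real.exp (-((1 + α) * t))) / 2 * ∫ z, F z * v z := by
        rw [integral_div, integral_add h_int h_intA, integral_grushinGradSq_comp_dilation,
          h_energy]
        ring

theorem exists_eventually_abs_sub_comp_dilation_le {ι : Type*} [Fintype ι]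
    {v : EuclideanSpace ℝ ι → ℝ} (hv : LipschitzWith L v) (hv_supp : HasCompactSupport v)
    (a : ι → ℝ) : ∃ C R, ∀ᶠ t in 𝓝 (0 : ℝ), ∀ z,
      |v z - v (dilation a t z)| ≤ C * |t| ∧ (R < ‖z‖ → v (dilation a t z) = v z) := by
  obtain ⟨r, hr⟩ := hv_supp.isCompact.isBounded.exists_norm_le
  have h_notMem {z : EuclideanSpace ℝ ι} (hz : r < ‖z‖) : v z = 0 :=
    image_eq_zero_of_notMem_tsupport fun h => hz.not_ge (hr z h)
  refine ⟨L * (2 * ‖a‖ * (2 * |r|)), 2 * |r|, ?_⟩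
  have h_small : ∀ᶠ t in 𝓝 (0 : ℝ), ‖a‖ * |t| < 1 / 4 :=
    ((continuous_abs.const_mul ‖a‖).tendsto' 0 0 (by simp)).eventually_lt_const (by norm_num)
  filter_upwards [h_small] with t ht z
  have h_dist := norm_dilation_sub_self_le (by linarith : ‖a‖ * |t| ≤ 1) z
  have h_far (hz : 2 * |r| < ‖z‖) : v (dilation a t z) = v z := by
    have h_tri := norm_sub_norm_le z (dilation a t z)
    rw [norm_sub_rev] at h_tri
    have h_half : 2 * ‖a‖ * |t| * ‖z‖ ≤ ‖z‖ / 2 := by nlinarith [norm_nonneg z]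
    have hr_abs := le_abs_self r
    have hr_nonneg := abs_nonneg r
    rw [h_notMem (by linarith), h_notMem (by linarith)]
  refine ⟨?_, h_far⟩
  rcases le_or_gt ‖z‖ (2 * |r|) with hz | hz
  · calc |v z - v (dilation a t z)| ≤ L * ‖dilation a t z - z‖ := by
          rw [norm_sub_rev, ← dist_eq_norm]
          exact hv.dist_le_mul _ _
      _ ≤ L * (2 * ‖a‖ * |t| * (2 * |r|)) := by
          gcongr
          exact h_dist.trans (by gcongr)
      _ = L * (2 * ‖a‖ * (2 * |r|)) * |t| := by ring
  · rw [h_far hz, sub_self, abs_zero]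
    positivity

theorem exists_eventually_integral_mul_sq_sub_comp_dilation_le {ι : Type*} [Fintype ι]
    {w v : EuclideanSpace ℝ ι → ℝ} (hw : Continuous w) (hv : LipschitzWith L v)
    (hv_supp : HasCompactSupport v) (a : ι → ℝ) :
    ∃ M, ∀ᶠ t in 𝓝 (0 : ℝ), ∫ z, w z * (v z - v (dilation a t z)) ^ 2 ≤ M * t ^ 2 := by
  obtain ⟨D, R, hDR⟩ := exists_eventually_abs_sub_comp_dilation_le hv hv_supp a
  set B : Set (EuclideanSpace ℝ ι) := Metric.closedBall 0 R
  have hB : IsCompact B := isCompact_closedBall _ _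
  obtain ⟨C, hC⟩ := hB.exists_bound_of_continuousOn hw.continuousOn
  refine ⟨C * D ^ 2 * volume.real B, hDR.mono fun t ht => ?_⟩
  have h_zero (z) (hz : z ∉ B) : w z * (v z - v (dilation a t z)) ^ 2 = 0 := by
    rw [(ht z).2 (not_le.1 (mem_closedBall_zero_iff.not.1 hz)), sub_self, zero_pow two_ne_zero,
      mul_zero]
  have h_bound (z) (hz : z ∈ B) : ‖w z * (v z - v (dilation a t z)) ^ 2‖ ≤ C * (D * |t|) ^ 2 := by
    have hC_nonneg := (norm_nonneg _).trans (hC z hz)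
    rw [norm_mul, norm_pow]
    gcongr
    exacts [hC z hz, (ht z).1]
  calc ∫ z, w z * (v z - v (dilation a t z)) ^ 2
      = ∫ z in B, w z * (v z - v (dilation a t z)) ^ 2 :=
        (setIntegral_eq_integral_of_forall_compl_eq_zero h_zero).symm
    _ ≤ C * (D * |t|) ^ 2 * volume.real B := (le_abs_self _).trans
        (norm_setIntegral_le_of_norm_le_const hB.measure_lt_top h_bound)
    _ = C * D ^ 2 * volume.real B * t ^ 2 := by
        rw [mul_pow, sq_abs]
        ring

end Comparison

theorem mul_sub_le_of_hasDerivAt_of_lipschitzOnWith {G g : ℝ → ℝ} {s : Set ℝ} {K : NNReal}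
    (hs : Convex ℝ s) (hG : ∀ x ∈ s, HasDerivAt G (g x) x) (hg : LipschitzOnWith K g s) {a b : ℝ}
    (ha : a ∈ s) (hb : b ∈ s) : g a * (a - b) ≤ G a - G b + K * (a - b) ^ 2 := by
  have h_sub : uIcc a b ⊆ s := by
    rw [← segment_eq_uIcc]
    exact hs.segment_subset ha hb
  have h_mvt := (convex_uIcc a b).norm_image_sub_le_of_norm_hasDerivWithin_le
    (f := fun x => G x - g a * x) (f' := fun x => g x - g a) (C := K * |a - b|)
    (fun x hx => ((hG x (h_sub hx)).sub
      (by simpa using (hasDerivAt_id x).const_mul (g a))).hasDerivWithinAt)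
    (fun x hx => (hg.dist_le_mul x (h_sub hx) a ha).trans <| by
      gcongr
      rw [Real.dist_eq, abs_sub_comm a b]
      exact abs_sub_left_of_mem_uIcc hx) left_mem_uIcc right_mem_uIcc
  rw [Real.norm_eq_abs, Real.norm_eq_abs, abs_sub_comm b a, mul_assoc, ← sq, sq_abs] at h_mvt
  linarith [(abs_le.1 h_mvt).2]

theorem contDiff_abs_rpow_mul_self {q : ℝ} (hq : 1 < q) :
    ContDiff ℝ 1 fun t : ℝ => |t| ^ q * t :=
  (contDiff_norm_rpow (E := ℝ) hq).mul contDiff_id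

theorem hasDerivAt_abs_rpow_div {q : ℝ} (hq : 1 < q) (t : ℝ) :
    HasDerivAt (fun t : ℝ => |t| ^ q / q) (|t| ^ (q - 2) * t) t := by
  refine ((hasDerivAt_abs_rpow t hq).div_const q).congr_deriv ?_
  field_simp

theorem abs_rpow_mul_self_mul_self {q : ℝ} (hq : q + 1 ≠ 0) (t : ℝ) :
    |t| ^ (q - 1) * t * t = |t| ^ (q + 1) := by
  rcases eq_or_ne t 0 with rfl | ht
  · simp [Real.zero_rpow hq]
  · rw [mul_assoc, ← sq, ← sq_abs, ← Real.rpow_two, ← Real.rpow_add (abs_pos.2 ht)]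
    ring_nf

theorem nonpos_of_eventually_exp_le {a p E M : ℝ} (ha : 0 < a) (hp : 5 < p)
    (h : ∀ᶠ t in 𝓝[>] (0 : ℝ), (1 - Real.exp (-(a * t))) / 2 * E ≤
      (1 - Real.exp (-(3 * a * t))) / (p + 1) * E + M * t ^ 2) : E ≤ 0 := by
  have h_exp (b : ℝ) : HasDerivAt (fun t => 1 - Real.exp (-(b * t))) b 0 := by
    simpa using (((hasDerivAt_id (0 : ℝ)).const_mul b).neg.exp).const_sub 1
  have h_deriv : HasDerivAt (fun t => (1 - Real.exp (-(3 * a * t))) / (p + 1) * E + M * t ^ 2 -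
      (1 - Real.exp (-(a * t))) / 2 * E) (3 * a / (p + 1) * E - a / 2 * E) 0 := by
    exact (((((h_exp (3 * a)).div_const (p + 1)).mul_const E).add
      ((hasDerivAt_pow 2 (0 : ℝ)).const_mul M)).sub
        (((h_exp a).div_const 2).mul_const E)).congr_deriv (by simp)
  have h_slope := (hasDerivWithinAt_iff_tendsto_slope' (notMem_Ioi.2 le_rfl)).1
    (h_deriv.hasDerivWithinAt (s := Ioi 0))
  have h_nonneg : 0 ≤ 3 * a / (p + 1) * E - a / 2 * E := by
    refine ge_of_tendsto h_slope ?_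
    filter_upwards [h, self_mem_nhdsWithin] with t ht (ht_pos : 0 < t)
    rw [slope_def_field]
    refine div_nonneg ?_ (by linarith)
    simp only [mul_zero, neg_zero, Real.exp_zero, sub_self, zero_div, zero_mul, ne_eq,
      OfNat.ofNat_ne_zero, not_false_eq_true, zero_pow, add_zero, sub_zero]
    linarith
  have h_lt : 3 * a / (p + 1) < a / 2 := by
    rw [div_lt_div_iff₀ (by linarith) two_pos]
    nlinarith
  nlinarith

section Pohozaev

variable {α p : ℝ} {Ω : Opens Space3} {v : Space3 → ℝ} {L : NNReal}

theorem exists_eventually_integral_mul_sub_comp_dilation_le (hα : 0 ≤ α)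
    (hv : LipschitzWith L v) (hv_supp : HasCompactSupport v) {G g : ℝ → ℝ}
    (hG : ∀ x, HasDerivAt G (g x) x) (hG0 : G 0 = 0) (hg : ContDiff ℝ 1 g) :
    ∃ M, ∀ᶠ t in 𝓝 (0 : ℝ),
      ∫ z, weight α z * (g (v z) * (v z - v (dilation (grushinExponents α) t z))) ≤
        (1 - Real.exp (-(3 * (1 + α) * t))) * (∫ z, weight α z * G (v z)) + M * t ^ 2 := by
  have hG_cont : Continuous G := continuous_iff_continuousAt.2 fun x => (hG x).continuousAt
  obtain ⟨R, hR⟩ := hv_supp.exists_bound_of_continuous hv.continuous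
  obtain ⟨K, hK⟩ := hg.contDiffOn.exists_lipschitzOnWith one_ne_zero (convex_Icc (-R) R)
    isCompact_Icc
  obtain ⟨M, hM⟩ := exists_eventually_integral_mul_sq_sub_comp_dilation_le (continuous_weight hα)
    hv hv_supp (grushinExponents α)
  refine ⟨K * M, hM.mono fun t ht => ?_⟩
  set A := dilation (grushinExponents α) t
  have hvA : Continuous fun z => v (A z) := hv.continuous.comp A.continuous
  have hvA_supp : HasCompactSupport fun z => v (A z) := hv_supp.comp_homeomorph A.toHomeomorph
  have h_sub_supp : HasCompactSupport fun z => v z - v (A z) := hv_supp.sub hvA_supp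
  have h_sq_supp : HasCompactSupport fun z => (v z - v (A z)) ^ 2 :=
    h_sub_supp.comp_left (g := (· ^ 2)) (zero_pow two_ne_zero)
  have h_intG : Integrable fun z => weight α z * G (v z) :=
    integrable_weight_mul hα (hG_cont.comp hv.continuous) (hv_supp.comp_left hG0)
  have h_intGA : Integrable fun z => weight α z * G (v (A z)) :=
    integrable_weight_mul hα (hG_cont.comp hvA) (hvA_supp.comp_left hG0)
  have h_int_sq : Integrable fun z => K * (weight α z * (v z - v (A z)) ^ 2) :=
    (integrable_weight_mul hα ((hv.continuous.sub hvA).pow 2) h_sq_supp).const_mul _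
  have h_descent (z) : g (v z) * (v z - v (A z)) ≤
      G (v z) - G (v (A z)) + K * (v z - v (A z)) ^ 2 :=
    mul_sub_le_of_hasDerivAt_of_lipschitzOnWith (convex_Icc (-R) R) (fun x _ => hG x) hK
      (abs_le.1 (hR z)) (abs_le.1 (hR (A z)))
  calc ∫ z, weight α z * (g (v z) * (v z - v (A z)))
      ≤ ∫ z, (weight α z * G (v z) - weight α z * G (v (A z)) +
          K * (weight α z * (v z - v (A z)) ^ 2)) :=
        integral_mono (integrable_weight_mul hα ((hg.continuous.comp hv.continuous).mul
          (hv.continuous.sub hvA)) h_sub_supp.mul_left) ((h_intG.sub h_intGA).add h_int_sq) fun z =>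
            (mul_le_mul_of_nonneg_left (h_descent z) (weight_nonneg α z)).trans_eq (by ring)
    _ = (1 - Real.exp (-(3 * (1 + α) * t))) * (∫ z, weight α z * G (v z)) +
          K * ∫ z, weight α z * (v z - v (A z)) ^ 2 := by
        rw [integral_add (f := fun z => weight α z * G (v z) - weight α z * G (v (A z)))
          (h_intG.sub h_intGA) h_int_sq, integral_sub h_intG h_intGA, integral_const_mul,
          integral_weight_mul_comp_dilation α t fun z => G (v z)]
        ring
    _ ≤ (1 - Real.exp (-(3 * (1 + α) * t))) * (∫ z, weight α z * G (v z)) + K * M * t ^ 2 := by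
        rw [mul_assoc (K : ℝ)]
        gcongr

theorem integral_weight_mul_abs_rpow_nonpos (hα : 0 ≤ α) (hp : 5 < p)
    (hΩ : IsDilationStarShaped α Ω) (hv : IsC1ExtensionByZero Ω v) (hvL : LipschitzWith L v)
    (hv_supp : HasCompactSupport v) (h : HasWeakDivergence volume Ω (grushinField α v)
      fun z => -(weight α z * (|v z| ^ (p - 1) * v z))) :
    ∫ z, weight α z * |v z| ^ (p + 1) ≤ 0 := by
  set E := ∫ z, weight α z * |v z| ^ (p + 1) with hE
  set F : Space3 → ℝ := fun z => weight α z * (|v z| ^ (p - 1) * v z) with hF_def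
  have hG : ∀ x, HasDerivAt (fun x : ℝ => |x| ^ (p + 1) / (p + 1)) (|x| ^ (p - 1) * x) x := by
    have h_deriv := hasDerivAt_abs_rpow_div (q := p + 1) (by linarith)
    rwa [show p + 1 - 2 = p - 1 by ring] at h_deriv
  have hg := contDiff_abs_rpow_mul_self (q := p - 1) (by linarith)
  have hF_cont : Continuous F :=
    (continuous_weight hα).mul (hg.continuous.comp hv.continuous)
  have hF_supp : HasCompactSupport F := hv_supp.mul_left.mul_left
  have hF_int {ψ : Space3 → ℝ} (hψ : Continuous ψ) : Integrable fun z => F z * ψ z :=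
    (hF_cont.mul hψ).integrable_of_hasCompactSupport hF_supp.mul_right
  have hF_self : ∫ z, F z * v z = E := integral_congr_ae <| .of_forall fun z => by
    simp only [hF_def, mul_assoc (weight α z), abs_rpow_mul_self_mul_self (q := p) (by linarith)]
  obtain ⟨M, hM⟩ := exists_eventually_integral_mul_sub_comp_dilation_le hα hvL hv_supp hG
    (by simp [Real.zero_rpow (by linarith : p + 1 ≠ 0)]) hg
  refine nonpos_of_eventually_exp_le (a := 1 + α) (M := M) (by linarith) hp ?_
  filter_upwards [nhdsWithin_le_nhds hM, self_mem_nhdsWithin] with t h_upper (ht : 0 < t)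
  have h_lower := integral_mul_comp_dilation_le hα hΩ hv hvL hv_supp
    (hF_cont.integrable_of_hasCompactSupport hF_supp) h ht.le
  have hvA : Continuous fun z => v (dilation (grushinExponents α) t z) :=
    hv.continuous.comp (dilation (grushinExponents α) t).continuous
  have h_split : ∫ z, weight α z * (|v z| ^ (p - 1) * v z *
      (v z - v (dilation (grushinExponents α) t z))) =
        E - ∫ z, F z * v (dilation (grushinExponents α) t z) := by
    rw [← hF_self, ← integral_sub (hF_int hv.continuous) (hF_int hvA)]
    simp only [hF_def, mul_sub, mul_assoc]
  have h_potential : ∫ z, weight α z * (|v z| ^ (p + 1) / (p + 1)) = E / (p + 1) := by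
    simp only [hE, ← mul_div_assoc, integral_div]
  rw [h_split, h_potential] at h_upper
  rw [hF_self] at h_lower
  calc (1 - Real.exp (-((1 + α) * t))) / 2 * E
      = E - (1 + Real.exp (-((1 + α) * t))) / 2 * E := by ring
    _ ≤ E - ∫ z, F z * v (dilation (grushinExponents α) t z) := by linarith
    _ ≤ (1 - Real.exp (-(3 * (1 + α) * t))) * (E / (p + 1)) + M * t ^ 2 := h_upper
    _ = (1 - Real.exp (-(3 * (1 + α) * t))) / (p + 1) * E + M * t ^ 2 := by ring

theorem dense_weight_pos (α : ℝ) : Dense {z | 0 < weight α z} := by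
  have h_dense : Dense {z : Space3 | z 0 ≠ 0} := by
    refine (dense_compl_singleton (0 : ℝ)).preimage (f := fun z : Space3 => z 0) ?_
    exact (EuclideanSpace.proj (𝕜 := ℝ) (0 : Fin 3)).isOpenMap_of_ne_zero fun h_eq => by
      simpa using DFunLike.congr_fun h_eq (EuclideanSpace.single 0 1)
  exact h_dense.mono fun z hz => weight_pos α hz

theorem eq_zero_of_integral_weight_mul_abs_rpow_nonpos {q : ℝ} (hα : 0 ≤ α) (hq : 0 < q)
    (hv : Continuous v) (hv_supp : HasCompactSupport v)
    (h : ∫ z, weight α z * |v z| ^ q ≤ 0) : v = 0 := by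
  have h_cont : Continuous fun z => weight α z * |v z| ^ q :=
    (continuous_weight hα).mul (hv.abs.rpow_const fun _ => Or.inr hq.le)
  have h_supp : HasCompactSupport fun z => weight α z * |v z| ^ q :=
    (hv_supp.comp_left (g := fun t : ℝ => |t| ^ q) (by simp [Real.zero_rpow hq.ne'])).mul_left
  have h_nonneg (z) : 0 ≤ weight α z * |v z| ^ q :=
    mul_nonneg (weight_nonneg α z) (Real.rpow_nonneg (abs_nonneg _) _)
  have h_zero (z) : weight α z * |v z| ^ q = 0 := by
    by_contra hz
    exact h.not_gt (h_cont.integral_pos_of_hasCompactSupport_nonneg_nonzero h_supp h_nonneg hz)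
  refine hv.ext_on (dense_weight_pos α) continuous_const fun z (hz : 0 < weight α z) => ?_
  simpa [hz.ne', Real.rpow_eq_zero_iff_of_nonneg, hq.ne'] using h_zero z

end Pohozaev

end Grushin

theorem mainTheorem6_general {α : ℝ} (hα : 0 ≤ α) {p : ℝ} (hp : 5 < p)
    {Ω : TopologicalSpace.Opens Grushin.Space3}
    (hΩ : Bornology.IsBounded (Ω : Set Grushin.Space3)) (hstar : Grushin.IsDilationStarShaped α Ω)
    {u : Grushin.Space3 → ℝ} (hu : Grushin.MemC10 Ω u)
    (hsol : Grushin.IsSolution α Ω (fun z ξ => Grushin.weight α z * (|ξ| ^ (p - 1) * ξ)) u) :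
    ∀ z ∈ closure (Ω : Set Grushin.Space3), u z = 0 := by
  set v := (Ω : Set Grushin.Space3).indicator u with hv_def
  have hv : Grushin.IsC1ExtensionByZero Ω v := hu.isC1ExtensionByZero_indicator
  obtain ⟨L, hvL⟩ := hu.exists_lipschitzWith_indicator hΩ
  have hv_supp : HasCompactSupport v := .intro hΩ.isCompact_closure fun z hz =>
    hv.eq_zero_of_notMem z fun hzΩ => hz (subset_closure hzΩ)
  have h_weak : Grushin.HasWeakDivergence volume Ω (Grushin.grushinField α v)
      fun z => -(Grushin.weight α z * (|v z| ^ (p - 1) * v z)) :=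
    (hsol.hasWeakDivergence hα hu.contDiffOn).congr
      (fun z hz => (Grushin.grushinField_indicator_of_mem hz).symm)
      fun z hz => by simp only [hv_def, Set.indicator_of_mem hz]
  have hv_zero : v = 0 := Grushin.eq_zero_of_integral_weight_mul_abs_rpow_nonpos hα
    (by linarith) hv.continuous hv_supp
    (Grushin.integral_weight_mul_abs_rpow_nonpos hα hp hstar hv hvL hv_supp h_weak)
  intro z hz
  by_cases hzΩ : z ∈ (Ω : Set Grushin.Space3)
  · simpa [hv_def, hzΩ] using congr_fun hv_zero z
  · exact hu.eq_zero_of_mem_frontier z (Ω.isOpen.frontier_eq ▸ ⟨hz, hzΩ⟩)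

theorem mainTheorem6 (α : ℝ) (hα : 0 < α) (p : ℝ) (hp : 5 < p)
    (Ω : TopologicalSpace.Opens Grushin.Space3) (hΩ : Grushin.IsBoundedSmoothDomain Ω)
    (hstar : Grushin.IsStarShaped α Ω) :
    ¬ ∃ u : Grushin.Space3 → ℝ, Grushin.MemS2 α Ω u ∧
      Grushin.IsSolution α Ω (fun z ξ => Grushin.weight α z * (|ξ| ^ (p - 1) * ξ)) u ∧
      ∃ z ∈ closure (Ω : Set Grushin.Space3), u z ≠ 0 :=
  fun ⟨_, hu, hsol, z, hz, hne⟩ => hne <| mainTheorem6_general hα.le hp hΩ.isBounded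
    (hstar.isDilationStarShaped hΩ) hu.1 hsol z hz
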